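/- Let $\mathfrak h=\mathbb C^N$, let $L(\mathfrak h)$ be the space of linear operators on $\mathfrak h$ with the Hilbert--Schmidt product $\langle\!\langle A,B\rangle\!\rangle=\mathrm{Tr}(A^*B)$, and let $\mathcal L^*$ be the adjoint of a linear map $\mathcal L:L(\mathfrak h)\to L(\mathfrak h)$ for this product. Let $H=H^*\in L(\mathfrak h)$, $\beta>0$, $\hat\rho_\beta=\frac1{Z_\beta}e^{-\beta H}$ with $Z_\beta=\mathrm{Tr}\,e^{-\beta H}$. A Lindblad operator is a linear map of the form $\mathcal L A=\sum_{p,q}a_{pq}\big([V_p,AV_q^*]+[V_pA,V_q^*]\big)$ (finite sum) with $V_p\in L(\mathfrak h)$ and $(a_{pq})$ Hermitian positive semidefinite. It satisfies the detailed balance condition (DBC) with respect to $\hat\rho_\beta$ if $\mathcal L\hat\rho_\beta=0$ and $\langle\!\langle \mathcal L^*A,B\hat\rho_\beta\rangle\!\rangle=\langle\!\langle A,(\mathcal L^*B)\hat\rho_\beta\rangle\!\rangle$ for all $A,B$. Put $\mathcal F(\rho)=\mathrm{Tr}(\rho(\log\rho-\log\hat\rho_\beta))$, $$\mathcal C_\rho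 A=\int_0^1\rho^sA\rho^{1-s}\,ds,\qquad \mathcal D^\alpha_\rho A=e^{-\alpha/2}\int_0^1e^{s\alpha}\rho^sA\rho^{1-s}\,ds .$$ An Onsager operator $\mathbb K$ assigns to every density matrix $\rho$ (that is, $\rho=\rho^*\ge0$, $\mathrm{Tr}\rho=1$) a linear map $\mathbb K(\rho)$ on $L(\mathfrak h)$ that maps Hermitian operators to Hermitian operators and is symmetric and positive semidefinite for $\langle\!\langle\cdot,\cdot\rangle\!\rangle$. We say that $\mathcal L$ is the $\mathbb K$-gradient of $\mathcal F$ if for every density matrix $\rho>0$ the differential of $\mathcal F$ at $\rho$ (along Hermitian directions of trace $0$) is represented by $\log\rho+\beta H$, and $$\mathcal L\rho=-\mathbb K(\rho)\big(\log\rho+\beta H\big),$$ and likewise $\mathcal L\rho=-\mathbb K(\rho)G$ for every Hermitian $G$ representing this differential. **Theorem.** Let $\mathcal L$ be a Lindblad operator satisfying the DBC with respect to $\hat\rho_\beta$. Then there is an Onsager operator $\mathbb K$ such that $\mathcal L$ is the $\mathbb K$-gradient of $\mathcal F$. More precisely: (1) With $\mathfrak h_2=\mathfrak h$, there is a Hermitian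 $\mathbb Q\in L(\mathfrak h\otimes\mathfrak h_2)$ with $[\mathbb Q,\hat\rho_\beta\otimes\hat\rho_\beta]=0$ and $$\mathcal L A=-\mathrm{Tr}_{\mathfrak h_2}\big[\mathbb Q,[\mathbb Q,A\otimes\hat\rho_\beta]\big]\quad\text{for all }A\in L(\mathfrak h).$$ For every such $\mathbb Q$, $\mathcal L$ is the $\mathbb K$-gradient of $\mathcal F$ for the Onsager operator $$\mathbb K(\rho)\xi=\mathrm{Tr}_{\mathfrak h_2}\big[\mathbb Q,\mathcal C_{\rho\otimes\hat\rho_\beta}[\mathbb Q,\xi\otimes\mathbf 1]\big].$$ Moreover, let $(e_j)$ be any orthonormal eigenbasis of $\hat\rho_\beta$, let $\mathcal T$ be the linear map with $\mathcal T(A\otimes e_je_k^*)=A\otimes e_ke_j^*$, and let $\tilde{\mathbb Q}=(\mathbf 1\otimes\hat\rho_\beta^{1/2})(\mathcal T\mathbb Q)(\mathbf 1\otimes\hat\rho_\beta^{1/2})$. Then $\mathcal L A=-\mathrm{Tr}_{\mathfrak h_2}[\tilde{\mathbb Q},[\tilde{\mathbb Q},A\otimes\hat\rho_\beta^{-1}]]$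 for all $A$, and $\mathbb K(\rho)\xi=\mathrm{Tr}_{\mathfrak h_2}\big[\tilde{\mathbb Q},\mathcal C_{\rho\otimes\hat\rho_\beta^{-1}}[\tilde{\mathbb Q},\xi\otimes\mathbf 1]\big]$ for all density matrices $\rho$ and all $\xi\in L(\mathfrak h)$. (2) There are finitely many pairs $(\omega_m,Q_m)\in\mathbb R\times L(\mathfrak h)$ with $[Q_m,H]=\omega_mQ_m$ and $\mathcal L=\sum_m\mathcal M^\beta_{Q_m}$, where $$\mathcal M^\beta_{Q_m}A=e^{\beta\omega_m/2}\big([Q_m,AQ_m^*]+[Q_mA,Q_m^*]\big)+e^{-\beta\omega_m/2}\big([Q_m^*,AQ_m]+[Q_m^*A,Q_m]\big).$$ For every such representation, $\mathcal L$ is the $\mathbb K$-gradient of $\mathcal F$ for the Onsager operator $\mathbb K(\rho)=\sum_m\mathcal K^\beta_{Q_m}(\rho)$, where $$\mathcal K^\beta_{Q_m}(\rho)\xi=\big[Q_m^*,\mathcal D^{-\beta\omega_m}_\rho[Q_m,\xi]\big]+\big[Q_m,\mathcal D^{\beta\omega_m}_\rho[Q_m^*,\xi]\big].$$ -/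

import Mathlib

open scoped Matrix Kronecker ComplexOrder

namespace LindbladGradient

noncomputable section

/- The Hilbert space is `ℂ^n` for a finite index type `n`, so the space of linear operators
`L(𝔥)` is `Matrix n n ℂ`, and `L(𝔥 ⊗ 𝔥₂)` is `Matrix (n × m) (n × m) ℂ` with `A ⊗ B` the
Kronecker product `A ⊗ₖ B`. Commutators are the Mathlib brackets `⁅A, B⁆ = A * B - B * A`. -/

/-- The Hilbert-Schmidt scalar product `⟪A, B⟫ = Tr (A* B)`, conjugate linear in `A`. -/
def hs {n : Type*} [Fintype n] (A B : Matrix n n ℂ) : ℂ := (Aᴴ * B).trace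

/-- Density matrices: `ρ = ρ* ≥ 0` with `Tr ρ = 1`. -/
def IsDensity {n : Type*} [Fintype n] (ρ : Matrix n n ℂ) : Prop :=
  ρ.PosSemidef ∧ ρ.trace = 1

/-- The equilibrium state `Z⁻¹ exp (-β H)` with `Z = Tr (exp (-β H))`. -/
def gibbs {n : Type*} [Fintype n] [DecidableEq n] (β : ℝ) (H : Matrix n n ℂ) :
    Matrix n n ℂ :=
  (NormedSpace.exp (-(β • H))).trace⁻¹ • NormedSpace.exp (-(β • H))

/-- The power `ρ ^ s` of a positive semidefinite matrix, through the functional calculus. -/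
def mpow {n : Type*} [Fintype n] [DecidableEq n] (ρ : Matrix n n ℂ) (s : ℝ) :
    Matrix n n ℂ :=
  cfc (fun x : ℝ => x ^ s) ρ

/-- The logarithm of a positive definite matrix, through the functional calculus. -/
def mlog {n : Type*} [Fintype n] [DecidableEq n] (ρ : Matrix n n ℂ) : Matrix n n ℂ :=
  cfc Real.log ρ

/-- The partial trace over the second tensor factor. -/
def trSnd {n m : Type*} [Fintype m] (X : Matrix (n × m) (n × m) ℂ) : Matrix n n ℂ :=
  Matrix.of fun i j => ∑ k, X (i, k) (j, k)

theorem trSnd_kronecker {n m : Type*} [Fintype m] (A : Matrix n n ℂ) (B : Matrix m m ℂ) :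
    trSnd (A ⊗ₖ B) = B.trace • A := by
  ext i j
  simp [trSnd, Matrix.trace, Finset.mul_sum, mul_comm]

/-- Lindblad operators:
`L A = ∑ p q, a p q ([V p, A (V q)*] + [(V p) A, (V q)*])` with finitely many arbitrary
operators `V p` and a Hermitian positive semidefinite coefficient matrix `a`. -/
def IsLindblad {n : Type*} [Fintype n] (L : Matrix n n ℂ →ₗ[ℂ] Matrix n n ℂ) : Prop :=
  ∃ (k : ℕ) (V : Fin k → Matrix n n ℂ) (a : Matrix (Fin k) (Fin k) ℂ),
    a.PosSemidef ∧
    ∀ A, L A = ∑ p, ∑ q, a p q • (⁅V p, A * (V q)ᴴ⁆ + ⁅V p * A, (V q)ᴴ⁆)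

/-- The adjoint `L*` of `L` for the Hilbert-Schmidt scalar product, see `hs_hsAdjoint`. -/
def hsAdjoint {n : Type*} [Fintype n] [DecidableEq n]
    (L : Matrix n n ℂ →ₗ[ℂ] Matrix n n ℂ) (A : Matrix n n ℂ) : Matrix n n ℂ :=
  Matrix.of fun i j => star (hs A (L (Matrix.single i j 1)))

theorem hs_hsAdjoint {n : Type*} [Fintype n] [DecidableEq n]
    (L : Matrix n n ℂ →ₗ[ℂ] Matrix n n ℂ) (A B : Matrix n n ℂ) :
    hs (hsAdjoint L A) B = hs A (L B) := by
  have h : L B = ∑ i, ∑ j, B i j • L (Matrix.single i j 1) := by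
    conv_lhs => rw [Matrix.matrix_eq_sum_single B]
    simp only [map_sum]
    refine Finset.sum_congr rfl fun i _ => Finset.sum_congr rfl fun j _ => ?_
    rw [← map_smul, Matrix.smul_single, smul_eq_mul, mul_one]
  rw [h]
  have h2 : hs A (∑ i, ∑ j, B i j • L (Matrix.single i j 1)) =
      ∑ i, ∑ j, B i j * hs A (L (Matrix.single i j 1)) := by
    simp [hs, Finset.mul_sum, Matrix.trace_sum]
  rw [h2, Finset.sum_comm]
  simp only [hs, Matrix.trace, Matrix.diag, Matrix.mul_apply, Matrix.conjTranspose_apply,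
    hsAdjoint, Matrix.of_apply, star_star]
  refine Finset.sum_congr rfl fun i _ => Finset.sum_congr rfl fun j _ => ?_
  rw [mul_comm]

/-- The detailed balance condition with respect to the state `σ`. -/
def DetailedBalance {n : Type*} [Fintype n] [DecidableEq n]
    (L : Matrix n n ℂ →ₗ[ℂ] Matrix n n ℂ) (σ : Matrix n n ℂ) : Prop :=
  L σ = 0 ∧ ∀ A B, hs (hsAdjoint L A) (B * σ) = hs A (hsAdjoint L B * σ)

/-- The relative entropy `Tr (ρ (log ρ - log σ))`. -/
def relEntropy {n : Type*} [Fintype n] [DecidableEq n] (σ ρ : Matrix n n ℂ) : ℝ :=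
  (ρ * (mlog ρ - mlog σ)).trace.re

/-- The Hermitian matrix `G` represents the differential of `F` at the density matrix `ρ`:
`d/dt F (ρ + t v) = Tr (G v)` at `t = 0` for all directions `v` tangent to the set of density
matrices, i.e. `v` Hermitian with `Tr v = 0`. -/
def IsDifferentialAt {n : Type*} [Fintype n] (F : Matrix n n ℂ → ℝ)
    (ρ G : Matrix n n ℂ) : Prop :=
  G.IsHermitian ∧ ∀ v : Matrix n n ℂ, v.IsHermitian → v.trace = 0 →
    HasDerivAt (fun t : ℝ => F (ρ + t • v)) (G * v).trace.re 0

/-- `K` is an Onsager operator: for every density matrix `ρ`, `K ρ` is linear, maps Hermitian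
matrices to Hermitian matrices, and is symmetric and positive semidefinite for the
Hilbert-Schmidt scalar product. -/
def IsOnsager {n : Type*} [Fintype n] (K : Matrix n n ℂ → Matrix n n ℂ → Matrix n n ℂ) :
    Prop :=
  ∀ ρ, IsDensity ρ →
    IsLinearMap ℂ (K ρ) ∧
    (∀ ξ, ξ.IsHermitian → (K ρ ξ).IsHermitian) ∧
    (∀ ξ η, hs (K ρ ξ) η = hs ξ (K ρ η)) ∧
    (∀ ξ, 0 ≤ (hs ξ (K ρ ξ)).re)

/-- `L` is the `K`-gradient of the relative entropy with respect to the equilibrium state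
`gibbs β H`: at each positive definite density matrix `ρ` the differential of the relative
entropy is represented by `log ρ + β H`, one has `L ρ = - K ρ (log ρ + β H)`, and, more
generally, `L ρ = - K ρ G` for each Hermitian `G` that represents the differential. -/
def IsEntropicGradient {n : Type*} [Fintype n] [DecidableEq n] (β : ℝ) (H : Matrix n n ℂ)
    (L : Matrix n n ℂ →ₗ[ℂ] Matrix n n ℂ)
    (K : Matrix n n ℂ → Matrix n n ℂ → Matrix n n ℂ) : Prop :=
  ∀ ρ, IsDensity ρ → ρ.PosDef →
    IsDifferentialAt (relEntropy (gibbs β H)) ρ (mlog ρ + β • H) ∧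
    L ρ = -K ρ (mlog ρ + β • H) ∧
    ∀ G, IsDifferentialAt (relEntropy (gibbs β H)) ρ G → L ρ = -K ρ G

/-- The Kubo-Mori operator `C_ρ A = ∫₀¹ ρ^s A ρ^(1-s) ds` (integral taken entrywise). -/
def kuboMori {n : Type*} [Fintype n] [DecidableEq n] (ρ A : Matrix n n ℂ) : Matrix n n ℂ :=
  Matrix.of fun i j => ∫ s in (0 : ℝ)..1, (mpow ρ s * A * mpow ρ (1 - s)) i j

/-- The tilted operator `D^α_ρ A = e^(-α/2) ∫₀¹ e^(s α) ρ^s A ρ^(1-s) ds`. -/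
def tiltedKuboMori {n : Type*} [Fintype n] [DecidableEq n] (α : ℝ) (ρ A : Matrix n n ℂ) :
    Matrix n n ℂ :=
  Real.exp (-α / 2) • Matrix.of fun i j =>
    ∫ s in (0 : ℝ)..1, (Real.exp (s * α) • (mpow ρ s * A * mpow ρ (1 - s))) i j

/-- The operator `A ↦ - Tr₂ [Q, [Q, A ⊗ σ]]`. -/
def tensorLindblad {n m : Type*} [Fintype n] [Fintype m]
    (Q : Matrix (n × m) (n × m) ℂ) (σ : Matrix m m ℂ) (A : Matrix n n ℂ) : Matrix n n ℂ :=
  -trSnd ⁅Q, ⁅Q, A ⊗ₖ σ⁆⁆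

/-- The operator `ξ ↦ Tr₂ [Q, C_{ρ ⊗ σ} [Q, ξ ⊗ 1]]`. -/
def tensorOnsager {n m : Type*} [Fintype n] [DecidableEq n] [Fintype m] [DecidableEq m]
    (Q : Matrix (n × m) (n × m) ℂ) (σ : Matrix m m ℂ) (ρ ξ : Matrix n n ℂ) :
    Matrix n n ℂ :=
  trSnd ⁅Q, kuboMori (ρ ⊗ₖ σ) ⁅Q, ξ ⊗ₖ (1 : Matrix m m ℂ)⁆⁆

/-- The partial transpose in the second tensor factor for the standard basis,
`A ⊗ B ↦ A ⊗ Bᵀ`. -/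
def transposeSnd {n m : Type*} (X : Matrix (n × m) (n × m) ℂ) :
    Matrix (n × m) (n × m) ℂ :=
  Matrix.of fun x y => X (x.1, y.2) (y.1, x.2)

theorem transposeSnd_kronecker {n m : Type*} (A : Matrix n n ℂ) (B : Matrix m m ℂ) :
    transposeSnd (A ⊗ₖ B) = A ⊗ₖ Bᵀ := by
  ext x y
  simp [transposeSnd]

/-- The partial transpose for the orthonormal basis of columns `e j` of the unitary matrix `U`:
`A ⊗ B ↦ A ⊗ B'`, where `B ↦ B'` is linear and swaps `e j (e k)*` and `e k (e j)*`. -/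
def transposeSndBasis {n m : Type*} [Fintype n] [DecidableEq n] [Fintype m] [DecidableEq m]
    (U : Matrix m m ℂ) (X : Matrix (n × m) (n × m) ℂ) : Matrix (n × m) (n × m) ℂ :=
  ((1 : Matrix n n ℂ) ⊗ₖ U) *
    transposeSnd (((1 : Matrix n n ℂ) ⊗ₖ Uᴴ) * X * ((1 : Matrix n n ℂ) ⊗ₖ U)) *
    ((1 : Matrix n n ℂ) ⊗ₖ Uᴴ)

/-- `Y_σ Q = (1 ⊗ σ^(1/2)) (T_σ Q) (1 ⊗ σ^(1/2))`, where the partial transpose `T_σ` is formed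
with the orthonormal basis of columns of `U`, which is meant to consist of eigenvectors
of `σ`. -/
def dualQ {n m : Type*} [Fintype n] [DecidableEq n] [Fintype m] [DecidableEq m]
    (σ U : Matrix m m ℂ) (Q : Matrix (n × m) (n × m) ℂ) : Matrix (n × m) (n × m) ℂ :=
  ((1 : Matrix n n ℂ) ⊗ₖ mpow σ (1 / 2)) * transposeSndBasis U Q *
    ((1 : Matrix n n ℂ) ⊗ₖ mpow σ (1 / 2))

/-- `(ω, Q)` is an eigenpair of `A ↦ [A, H]`, where `Q = 0` is allowed. -/
def IsEigenpair {n : Type*} [Fintype n] (H : Matrix n n ℂ) (ω : ℝ) (Q : Matrix n n ℂ) :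
    Prop :=
  ⁅Q, H⁆ = ω • Q

/-- The building block `M^β_Q` for an eigenpair `(ω, Q)`. -/
def blockLindblad {n : Type*} [Fintype n] (β ω : ℝ) (Q A : Matrix n n ℂ) : Matrix n n ℂ :=
  Real.exp (β * ω / 2) • (⁅Q, A * Qᴴ⁆ + ⁅Q * A, Qᴴ⁆) +
    Real.exp (-(β * ω / 2)) • (⁅Qᴴ, A * Q⁆ + ⁅Qᴴ * A, Q⁆)

/-- The block operator `K^β_Q` for an eigenpair `(ω, Q)`. -/
def blockOnsager {n : Type*} [Fintype n] [DecidableEq n] (β ω : ℝ) (Q ρ ξ : Matrix n n ℂ) :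
    Matrix n n ℂ :=
  ⁅Qᴴ, tiltedKuboMori (-(β * ω)) ρ ⁅Q, ξ⁆⁆ + ⁅Q, tiltedKuboMori (β * ω) ρ ⁅Qᴴ, ξ⁆⁆

end

end LindbladGradient

open LindbladGradient

/-!
Entropy: at `ρ > 0` the differential of the relative entropy is `log ρ - log σ`, where `σ` is the
equilibrium state, and `-log σ` is `β H` plus a multiple of the identity. Hermitian representatives
of the differential thus differ by multiples of `1`, which the Onsager operators annihilate.

Gradient structure: integrating the derivative of `s ↦ exp (s α) ρ^s Q ρ^(1-s)` over `[0, 1]` gives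
the noncommutative chain rule
`D^α_ρ ([Q, log ρ] - α Q) = exp (-α/2) Q ρ - exp (α/2) ρ Q`. If `[Q, H] = ω Q`, then
`[Q, log ρ + β H] = [Q, log ρ] + β ω Q`, so `α = -β ω` turns `K^β_Q` into `-M^β_Q`. In the tensor
form `[Q, σ ⊗ σ] = 0` gives `[Q, (log ρ + β H) ⊗ 1] = [Q, log (ρ ⊗ σ)]`, and `α = 0` applies.

Blocks: by detailed balance `L` commutes with `A ↦ σ A σ⁻¹`, so only diagonal terms survive when its
jump operators are split into eigenvectors of `[·, H]`, and `L A = ∑ᵢ (2 Vᵢ A Vᵢ* - …)` with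
eigenvectors `Vᵢ`. Detailed balance also gives `L A = L*(A σ⁻¹) σ`, which is the same sum with each
`Vᵢ` replaced by a multiple of `Vᵢ*`; the mean of the two is a sum of building blocks.

Tensor form: in an eigenbasis of `H` the Kossakowski matrix of `∑ₘ M^β_Qₘ` is the Gram matrix of all
`Qₘ` and `Qₘ*`, weighted by `exp (β ω / 2)` on the frequency `ω`. The square root of this Gram
matrix commutes with the frequencies and inherits the symmetry under adjunction; its entries,
suitably permuted and weighted by powers of `σ`, form the Hermitian `Q`.
-/

namespace LindbladGradient

noncomputable section

section Spectral

variable {n m : Type*} [Fintype n] [DecidableEq n] [Fintype m] [DecidableEq m]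
  (U : Matrix.unitaryGroup n ℂ)

/-- The automorphism `A ↦ U A U*` of the star algebra of operators. -/
abbrev unitaryConj : Matrix n n ℂ ≃⋆ₐ[ℂ] Matrix n n ℂ :=
  Unitary.conjStarAlgAut ℂ (Matrix n n ℂ) U

theorem unitaryConj_apply (A : Matrix n n ℂ) :
    unitaryConj U A = (U : Matrix n n ℂ) * A * (U : Matrix n n ℂ)ᴴ :=
  rfl

theorem unitaryConj_one (A : Matrix n n ℂ) : unitaryConj 1 A = A := by
  rw [unitaryConj, map_one, StarAlgEquiv.one_apply]

theorem unitaryConj_mul (V : Matrix.unitaryGroup n ℂ) (A : Matrix n n ℂ) :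
    unitaryConj (U * V) A = unitaryConj U (unitaryConj V A) := by
  rw [unitaryConj, map_mul, StarAlgEquiv.mul_apply]

theorem unitaryConj_surjective : Function.Surjective (unitaryConj U) :=
  EquivLike.surjective _

theorem trace_unitaryConj (A : Matrix n n ℂ) : (unitaryConj U A).trace = A.trace := by
  rw [unitaryConj_apply, Matrix.trace_mul_cycle, ← Matrix.star_eq_conjTranspose,
    Matrix.UnitaryGroup.star_mul_self, Matrix.one_mul]

/-- The matrix with eigenvalues `r` along the orthonormal basis of columns of `U`. As a
homomorphism of star algebras in `r` it turns the calculus of real functions on the index type into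
the functional calculus of Hermitian matrices. -/
def unitaryDiag : (n → ℝ) →⋆ₐ[ℝ] Matrix n n ℂ where
  toFun r := unitaryConj U (Matrix.diagonal fun j => (r j : ℂ))
  map_zero' := by simp
  map_one' := by simp
  map_mul' r s := by simp only [Pi.mul_apply, Complex.ofReal_mul, ← map_mul,
    Matrix.diagonal_mul_diagonal]
  map_add' r s := by simp only [Pi.add_apply, Complex.ofReal_add, ← map_add, Matrix.diagonal_add]
  commutes' c := by
    have h : (Matrix.diagonal fun _ => (c : ℂ) : Matrix n n ℂ) = algebraMap ℂ _ c := rfl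
    simp only [Pi.algebraMap_apply, Algebra.algebraMap_self, RingHom.id_apply, h,
      AlgHomClass.commutes]
    rfl
  map_star' r := by
    rw [← map_star, Matrix.star_eq_conjTranspose, Matrix.diagonal_conjTranspose]
    simp [Pi.star_def]

theorem unitaryDiag_apply (r : n → ℝ) :
    unitaryDiag U r = unitaryConj U (Matrix.diagonal fun j => (r j : ℂ)) :=
  rfl

theorem exists_eq_unitaryDiag {A : Matrix n n ℂ} (hA : A.IsHermitian) :
    ∃ (U : Matrix.unitaryGroup n ℂ) (r : n → ℝ), A = unitaryDiag U r :=
  ⟨hA.eigenvectorUnitary, hA.eigenvalues, hA.spectral_theorem⟩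

theorem isHermitian_unitaryDiag (r : n → ℝ) : (unitaryDiag U r).IsHermitian := by
  rw [Matrix.IsHermitian, ← Matrix.star_eq_conjTranspose, ← map_star, star_trivial]

theorem posSemidef_unitaryDiag_iff {r : n → ℝ} :
    (unitaryDiag U r).PosSemidef ↔ ∀ i, 0 ≤ r i := by
  rw [unitaryDiag_apply, unitaryConj_apply, ← Matrix.star_eq_conjTranspose,
    Matrix.IsUnit.posSemidef_star_right_conjugate_iff Unitary.isUnit_coe,
    Matrix.posSemidef_diagonal_iff]
  simp

theorem posDef_unitaryDiag_iff {r : n → ℝ} : (unitaryDiag U r).PosDef ↔ ∀ i, 0 < r i := by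
  rw [unitaryDiag_apply, unitaryConj_apply, ← Matrix.star_eq_conjTranspose,
    Matrix.IsUnit.posDef_star_right_conjugate_iff Unitary.isUnit_coe,
    Matrix.posDef_diagonal_iff]
  simp

theorem trace_unitaryDiag (r : n → ℝ) : (unitaryDiag U r).trace = ((∑ i, r i : ℝ) : ℂ) := by
  rw [unitaryDiag_apply, trace_unitaryConj, Matrix.trace_diagonal, Complex.ofReal_sum]

theorem spectrum_unitaryDiag_subset (r : n → ℝ) :
    spectrum ℝ (unitaryDiag U r) ⊆ Set.range r := by
  refine (AlgHom.spectrum_apply_subset (unitaryDiag U) r).trans ?_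
  rw [Pi.spectrum_eq, Set.iUnion_subset_iff]
  intro i x hx
  have hx' : x = r i := by
    simpa [spectrum.mem_iff, isUnit_iff_ne_zero, sub_eq_zero] using hx
  exact ⟨i, hx'.symm⟩

-- A polynomial interpolating `f` at the values of `r` commutes with the homomorphism.
theorem cfc_unitaryDiag (f : ℝ → ℝ) (r : n → ℝ) :
    cfc f (unitaryDiag U r) = unitaryDiag U (fun i => f (r i)) := by
  let p : Polynomial ℝ := Lagrange.interpolate (Finset.univ.image r) id f
  have hp (i : n) : p.eval (r i) = f (r i) :=
    Lagrange.eval_interpolate_at_node (v := id) f (Set.injOn_id _)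
      (Finset.mem_image_of_mem r (Finset.mem_univ i))
  calc cfc f (unitaryDiag U r) = cfc p.eval (unitaryDiag U r) := by
        refine cfc_congr fun x hx => ?_
        obtain ⟨i, rfl⟩ := spectrum_unitaryDiag_subset U r hx
        exact (hp i).symm
    _ = unitaryDiag U (Polynomial.aeval r p) := by
        rw [cfc_polynomial p _ (isHermitian_unitaryDiag U r).isSelfAdjoint]
        exact Polynomial.aeval_algHom_apply (unitaryDiag U) r p
    _ = unitaryDiag U (fun i => f (r i)) := by
        congr 1
        ext i
        rw [← hp]
        exact (Polynomial.aeval_algHom_apply (Pi.evalAlgHom ℝ (fun _ : n => ℝ) i) r p).symm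

theorem mpow_unitaryDiag (r : n → ℝ) (s : ℝ) :
    mpow (unitaryDiag U r) s = unitaryDiag U (fun i => r i ^ s) :=
  cfc_unitaryDiag U _ r

theorem mlog_unitaryDiag (r : n → ℝ) :
    mlog (unitaryDiag U r) = unitaryDiag U (fun i => Real.log (r i)) :=
  cfc_unitaryDiag U _ r

theorem inv_unitaryDiag {r : n → ℝ} (hr : ∀ i, r i ≠ 0) :
    (unitaryDiag U r)⁻¹ = unitaryDiag U r⁻¹ := by
  refine Matrix.inv_eq_right_inv ?_
  rw [← map_mul, ← map_one (unitaryDiag U)]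
  congr 1
  ext i
  exact mul_inv_cancel₀ (hr i)

theorem exp_unitaryDiag (r : n → ℝ) :
    NormedSpace.exp (unitaryDiag U r) = unitaryDiag U (fun i => Real.exp (r i)) := by
  have hinv : (U : Matrix n n ℂ)ᴴ = (U : Matrix n n ℂ)⁻¹ :=
    (Matrix.inv_eq_left_inv (Matrix.UnitaryGroup.star_mul_self U)).symm
  rw [unitaryDiag_apply, unitaryDiag_apply, unitaryConj_apply, unitaryConj_apply, hinv,
    Matrix.exp_conj _ _ Unitary.isUnit_coe, Matrix.exp_diagonal, Pi.exp_def]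
  simp only [Complex.ofReal_exp, Complex.exp_eq_exp_ℂ]

/-- The tensor product of two unitary matrices. -/
def kroneckerUnitary (U : Matrix.unitaryGroup n ℂ) (V : Matrix.unitaryGroup m ℂ) :
    Matrix.unitaryGroup (n × m) ℂ :=
  ⟨(U : Matrix n n ℂ) ⊗ₖ (V : Matrix m m ℂ), Matrix.kronecker_mem_unitary U.2 V.2⟩

theorem unitaryDiag_kronecker (V : Matrix.unitaryGroup m ℂ) (r : n → ℝ) (s : m → ℝ) :
    unitaryDiag U r ⊗ₖ unitaryDiag V s =
      unitaryDiag (kroneckerUnitary U V) (fun x => r x.1 * s x.2) := by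
  simp only [unitaryDiag_apply, unitaryConj_apply, kroneckerUnitary, Matrix.mul_kronecker_mul,
    Matrix.diagonal_kronecker_diagonal, Matrix.conjTranspose_kronecker, Complex.ofReal_mul]

end Spectral

section Gibbs

variable {n : Type*} [Fintype n]

/-- The eigenvalues of the equilibrium state of a Hamiltonian with eigenvalues `h`. -/
def gibbsWeight (β : ℝ) (h : n → ℝ) (i : n) : ℝ :=
  (∑ j, Real.exp (-(β * h j)))⁻¹ * Real.exp (-(β * h i))

theorem partition_pos [Nonempty n] (β : ℝ) (h : n → ℝ) : 0 < ∑ j, Real.exp (-(β * h j)) :=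
  Finset.sum_pos (fun _ _ => Real.exp_pos _) Finset.univ_nonempty

theorem gibbsWeight_pos (β : ℝ) (h : n → ℝ) (i : n) : 0 < gibbsWeight β h i :=
  have : Nonempty n := ⟨i⟩
  mul_pos (inv_pos.2 (partition_pos β h)) (Real.exp_pos _)

theorem log_gibbsWeight (β : ℝ) (h : n → ℝ) (i : n) :
    Real.log (gibbsWeight β h i) = -(β * h i) - Real.log (∑ j, Real.exp (-(β * h j))) := by
  have : Nonempty n := ⟨i⟩
  rw [gibbsWeight, Real.log_mul (inv_pos.2 (partition_pos β h)).ne' (Real.exp_pos _).ne',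
    Real.log_exp, Real.log_inv]
  ring

variable [DecidableEq n]

theorem gibbs_unitaryDiag (U : Matrix.unitaryGroup n ℂ) (β : ℝ) (h : n → ℝ) :
    gibbs β (unitaryDiag U h) = unitaryDiag U (gibbsWeight β h) := by
  rw [gibbs, ← map_smul, ← map_neg, exp_unitaryDiag, trace_unitaryDiag, ← Complex.ofReal_inv,
    Complex.coe_smul, ← map_smul]
  rfl

theorem posDef_gibbs {H : Matrix n n ℂ} (hH : H.IsHermitian) (β : ℝ) : (gibbs β H).PosDef := by
  obtain ⟨U, h, rfl⟩ := exists_eq_unitaryDiag hH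
  rw [gibbs_unitaryDiag, posDef_unitaryDiag_iff]
  exact gibbsWeight_pos β h

theorem exists_mlog_gibbs_eq {H : Matrix n n ℂ} (hH : H.IsHermitian) (β : ℝ) :
    ∃ c : ℝ, mlog (gibbs β H) = -(β • H) - c • 1 := by
  obtain ⟨U, h, rfl⟩ := exists_eq_unitaryDiag hH
  refine ⟨Real.log (∑ j, Real.exp (-(β * h j))), ?_⟩
  rw [gibbs_unitaryDiag, mlog_unitaryDiag, ← map_one (unitaryDiag U), ← map_smul, ← map_smul,
    ← map_neg, ← map_sub]
  congr 1
  ext i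
  simp [log_gibbsWeight]

end Gibbs

section TiltedMean

/-- The Schur multiplier of the tilted Kubo-Mori operator in an eigenbasis of the state. For `α = 0`
it is the logarithmic mean of `a` and `b`. -/
def tiltedMean (α a b : ℝ) : ℝ :=
  Real.exp (-α / 2) * ∫ s in (0 : ℝ)..1, Real.exp (s * α) * (a ^ s * b ^ (1 - s))

theorem intervalIntegrable_exp_mul_rpow (α : ℝ) {a b : ℝ} (ha : 0 ≤ a) (hb : 0 ≤ b) :
    IntervalIntegrable (fun s : ℝ => Real.exp (s * α) * (a ^ s * b ^ (1 - s)))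
      MeasureTheory.volume 0 1 := by
  have hexp : IntervalIntegrable (fun s : ℝ => Real.exp (s * α)) MeasureTheory.volume 0 1 :=
    Continuous.intervalIntegrable (by fun_prop) _ _
  rw [intervalIntegrable_iff_integrableOn_Ioc_of_le zero_le_one] at hexp ⊢
  refine hexp.mul_bdd (c := a + b) (by fun_prop)
    ((MeasureTheory.ae_restrict_iff' measurableSet_Ioc).2 (.of_forall fun s hs => ?_))
  rw [Real.norm_of_nonneg (mul_nonneg (Real.rpow_nonneg ha _) (Real.rpow_nonneg hb _))]
  calc a ^ s * b ^ (1 - s) ≤ s * a + (1 - s) * b :=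
        Real.geom_mean_le_arith_mean2_weighted hs.1.le (sub_nonneg.2 hs.2) ha hb (by ring)
    _ ≤ 1 * a + 1 * b := by gcongr; exacts [hs.2, sub_le_self 1 hs.1.le]
    _ = a + b := by ring

theorem tiltedMean_nonneg (α : ℝ) {a b : ℝ} (ha : 0 ≤ a) (hb : 0 ≤ b) : 0 ≤ tiltedMean α a b :=
  mul_nonneg (Real.exp_pos _).le (intervalIntegral.integral_nonneg zero_le_one fun _ _ =>
    mul_nonneg (Real.exp_pos _).le (mul_nonneg (Real.rpow_nonneg ha _) (Real.rpow_nonneg hb _)))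

theorem tiltedMean_neg (α a b : ℝ) : tiltedMean (-α) a b = tiltedMean α b a := by
  have hreflect := intervalIntegral.integral_comp_sub_left (a := 0) (b := 1)
    (fun s : ℝ => Real.exp (s * α) * (b ^ s * a ^ (1 - s))) 1
  rw [sub_zero, sub_self] at hreflect
  rw [tiltedMean, tiltedMean, ← hreflect, ← intervalIntegral.integral_const_mul,
    ← intervalIntegral.integral_const_mul]
  congr 1
  ext s
  have hexp : Real.exp (-(-α) / 2) * Real.exp (s * -α) =
      Real.exp (-α / 2) * Real.exp ((1 - s) * α) := by
    rw [← Real.exp_add, ← Real.exp_add]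
    congr 1
    ring
  rw [sub_sub_cancel, mul_comm (a ^ s), ← mul_assoc, hexp, mul_assoc]

theorem exp_mul_rpow_mul_rpow {a b : ℝ} (α s : ℝ) (ha : 0 < a) (hb : 0 < b) :
    Real.exp (s * α) * (a ^ s * b ^ (1 - s)) =
      b * Real.exp (s * (Real.log a + α - Real.log b)) := by
  calc Real.exp (s * α) * (a ^ s * b ^ (1 - s)) =
        Real.exp (Real.log b + s * (Real.log a + α - Real.log b)) := by
        rw [Real.rpow_def_of_pos ha, Real.rpow_def_of_pos hb, ← Real.exp_add, ← Real.exp_add]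
        congr 1
        ring
    _ = b * Real.exp (s * (Real.log a + α - Real.log b)) := by rw [Real.exp_add, Real.exp_log hb]

theorem integral_exp_mul_mul_self (c : ℝ) :
    (∫ s in (0 : ℝ)..1, Real.exp (s * c)) * c = Real.exp c - 1 := by
  have hderiv (s : ℝ) : HasDerivAt (fun s : ℝ => Real.exp (s * c)) (Real.exp (s * c) * c) s := by
    simpa using ((hasDerivAt_id s).mul_const c).exp
  rw [← intervalIntegral.integral_mul_const,
    intervalIntegral.integral_eq_sub_of_hasDerivAt (fun s _ => hderiv s)
      (Continuous.intervalIntegrable (by fun_prop) _ _)]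
  simp

theorem tiltedMean_mul_log {a b : ℝ} (α : ℝ) (ha : 0 < a) (hb : 0 < b) :
    tiltedMean α a b * (Real.log a + α - Real.log b) =
      Real.exp (α / 2) * a - Real.exp (-α / 2) * b := by
  have hexp : b * Real.exp (Real.log a + α - Real.log b) = Real.exp α * a := by
    rw [Real.exp_sub, Real.exp_add, Real.exp_log ha, Real.exp_log hb]
    field_simp
  have hhalf : Real.exp (-α / 2) * Real.exp α = Real.exp (α / 2) := by
    rw [← Real.exp_add]
    ring_nf
  rw [tiltedMean]
  simp only [exp_mul_rpow_mul_rpow α _ ha hb]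
  rw [intervalIntegral.integral_const_mul, mul_assoc, mul_assoc, integral_exp_mul_mul_self,
    mul_sub, hexp, ← hhalf]
  ring

end TiltedMean

section Bracket

-- The lemmas `lie_add`, `lie_smul`, ... are about the bracket of a Lie ring, which rewriting does
-- not unify with the instance `Ring.instBracket` that commutators of matrices elaborate to.

variable {R : Type*} [NonUnitalNonAssocRing R]

theorem bracket_add (a b c : R) : ⁅a, b + c⁆ = ⁅a, b⁆ + ⁅a, c⁆ := by
  simp only [Ring.lie_def, mul_add, add_mul]
  abel

theorem bracket_sub (a b c : R) : ⁅a, b - c⁆ = ⁅a, b⁆ - ⁅a, c⁆ := by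
  simp only [Ring.lie_def, mul_sub, sub_mul]
  abel

theorem neg_bracket (a b : R) : -⁅a, b⁆ = ⁅b, a⁆ :=
  neg_sub _ _

theorem bracket_smul {S : Type*} [Monoid S] [DistribMulAction S R] [IsScalarTower S R R]
    [SMulCommClass S R R] (c : S) (a b : R) : ⁅a, c • b⁆ = c • ⁅a, b⁆ := by
  simp only [Ring.lie_def, mul_smul_comm, smul_mul_assoc, smul_sub]

theorem smul_bracket {S : Type*} [Monoid S] [DistribMulAction S R] [IsScalarTower S R R]
    [SMulCommClass S R R] (c : S) (a b : R) : ⁅c • a, b⁆ = c • ⁅a, b⁆ := by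
  rw [Ring.lie_def, Ring.lie_def, smul_mul_assoc, mul_smul_comm, smul_sub]

end Bracket

section HilbertSchmidt

variable {n : Type*} [Fintype n]

theorem hs_eq_sum (A B : Matrix n n ℂ) : hs A B = ∑ i, ∑ j, star (A i j) * B i j := by
  simp only [hs, Matrix.trace, Matrix.diag, Matrix.mul_apply, Matrix.conjTranspose_apply]
  exact Finset.sum_comm

theorem star_hs (A B : Matrix n n ℂ) : star (hs A B) = hs B A := by
  simp [hs_eq_sum, mul_comm]

theorem hs_add_right (A B C : Matrix n n ℂ) : hs A (B + C) = hs A B + hs A C := by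
  rw [hs, Matrix.mul_add, Matrix.trace_add, hs, hs]

theorem hs_add_left (A B C : Matrix n n ℂ) : hs (A + B) C = hs A C + hs B C := by
  rw [hs, Matrix.conjTranspose_add, Matrix.add_mul, Matrix.trace_add, hs, hs]

theorem hs_sum_right {ι : Type*} (s : Finset ι) (A : Matrix n n ℂ) (f : ι → Matrix n n ℂ) :
    hs A (∑ i ∈ s, f i) = ∑ i ∈ s, hs A (f i) := by
  simp only [hs, Matrix.mul_sum, Matrix.trace_sum]

theorem hs_sum_left {ι : Type*} (s : Finset ι) (A : Matrix n n ℂ) (f : ι → Matrix n n ℂ) :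
    hs (∑ i ∈ s, f i) A = ∑ i ∈ s, hs (f i) A := by
  simp only [hs, Matrix.conjTranspose_sum, Matrix.sum_mul, Matrix.trace_sum]

theorem hs_conjTranspose_lie (Q X Y : Matrix n n ℂ) : hs X ⁅Qᴴ, Y⁆ = hs ⁅Q, X⁆ Y := by
  simp only [hs, Ring.lie_def, Matrix.conjTranspose_sub, Matrix.conjTranspose_mul, Matrix.mul_sub,
    Matrix.sub_mul, Matrix.trace_sub, Matrix.mul_assoc]
  congr 1
  rw [← Matrix.mul_assoc, Matrix.trace_mul_comm]

theorem conjTranspose_lie (A B : Matrix n n ℂ) : ⁅A, B⁆ᴴ = ⁅Bᴴ, Aᴴ⁆ := by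
  simp only [Ring.lie_def, Matrix.conjTranspose_sub, Matrix.conjTranspose_mul]

variable [DecidableEq n]

theorem hs_unitaryConj (U : Matrix.unitaryGroup n ℂ) (A B : Matrix n n ℂ) :
    hs (unitaryConj U A) (unitaryConj U B) = hs A B := by
  rw [hs, hs, ← Matrix.star_eq_conjTranspose, ← Matrix.star_eq_conjTranspose, ← map_star,
    ← map_mul, trace_unitaryConj]

theorem unitaryConj_lie (U : Matrix.unitaryGroup n ℂ) (A B : Matrix n n ℂ) :
    unitaryConj U ⁅A, B⁆ = ⁅unitaryConj U A, unitaryConj U B⁆ := by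
  simp only [Ring.lie_def, map_sub, map_mul]

end HilbertSchmidt

section KuboMori

variable {n : Type*} [Fintype n]

theorem intervalIntegral_mul_mul_apply {l m p : Type*} [Fintype m] {a b : ℝ} (A : Matrix l n ℂ)
    (C : Matrix m p ℂ) {F : ℝ → Matrix n m ℂ}
    (hF : ∀ i j, IntervalIntegrable (fun s => F s i j) MeasureTheory.volume a b) (x : l) (y : p) :
    ∫ s in a..b, (A * F s * C) x y =
      (A * Matrix.of (fun i j => ∫ s in a..b, F s i j) * C) x y := by
  have hAF (j : m) :
      IntervalIntegrable (fun s => ∑ i, A x i * F s i j) MeasureTheory.volume a b := by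
    simpa only [Finset.sum_fn] using
      IntervalIntegrable.sum Finset.univ fun i _ => (hF i j).const_mul (A x i)
  simp only [Matrix.mul_apply, Matrix.of_apply]
  rw [intervalIntegral.integral_finsetSum fun j _ => (hAF j).mul_const (C j y)]
  refine Finset.sum_congr rfl fun j _ => ?_
  rw [intervalIntegral.integral_mul_const,
    intervalIntegral.integral_finsetSum fun i _ => (hF i j).const_mul (A x i)]
  simp only [intervalIntegral.integral_const_mul]

variable [DecidableEq n]

theorem kuboMori_eq_tiltedKuboMori_zero (ρ A : Matrix n n ℂ) :
    kuboMori ρ A = tiltedKuboMori 0 ρ A := by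
  simp [kuboMori, tiltedKuboMori]

theorem tiltedKuboMori_unitaryDiag (U : Matrix.unitaryGroup n ℂ) (α : ℝ) {r : n → ℝ}
    (hr : ∀ i, 0 ≤ r i) (B : Matrix n n ℂ) :
    tiltedKuboMori α (unitaryDiag U r) (unitaryConj U B) =
      unitaryConj U (Matrix.of fun i j => (tiltedMean α (r i) (r j) : ℂ) * B i j) := by
  let F (s : ℝ) : Matrix n n ℂ :=
    Matrix.of fun i j => ((Real.exp (s * α) * (r i ^ s * r j ^ (1 - s)) : ℝ) : ℂ) * B i j
  have hF (i j : n) : IntervalIntegrable (fun s => F s i j) MeasureTheory.volume 0 1 := by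
    have h := intervalIntegrable_exp_mul_rpow α (hr i) (hr j)
    exact IntervalIntegrable.mul_const ⟨h.1.ofReal, h.2.ofReal⟩ _
  have hintegrand (s : ℝ) : Real.exp (s * α) • (mpow (unitaryDiag U r) s * unitaryConj U B *
      mpow (unitaryDiag U r) (1 - s)) = unitaryConj U (F s) := by
    rw [mpow_unitaryDiag, mpow_unitaryDiag, unitaryDiag_apply, unitaryDiag_apply, ← map_mul,
      ← map_mul, ← Complex.coe_smul, ← map_smul]
    congr 1
    ext i j
    simp only [Matrix.smul_apply, Matrix.mul_diagonal, Matrix.diagonal_mul, smul_eq_mul, F,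
      Matrix.of_apply]
    push_cast
    ring
  have hmean : (Real.exp (-α / 2) : ℂ) • Matrix.of (fun i j => ∫ s in (0 : ℝ)..1, F s i j) =
      Matrix.of fun i j => (tiltedMean α (r i) (r j) : ℂ) * B i j := by
    ext i j
    simp only [Matrix.smul_apply, F, Matrix.of_apply, intervalIntegral.integral_mul_const,
      intervalIntegral.integral_ofReal, smul_eq_mul, tiltedMean]
    rw [← mul_assoc, ← Complex.ofReal_mul]
  rw [tiltedKuboMori, ← hmean, map_smul, Complex.coe_smul]
  congr 1
  ext x y
  simp only [Matrix.of_apply, hintegrand]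
  exact intervalIntegral_mul_mul_apply _ _ hF x y

variable {ρ : Matrix n n ℂ}

theorem exists_tiltedKuboMori_eq (hρ : ρ.PosSemidef) :
    ∃ (U : Matrix.unitaryGroup n ℂ) (r : n → ℝ), (∀ i, 0 ≤ r i) ∧ ∀ α B,
      tiltedKuboMori α ρ (unitaryConj U B) =
        unitaryConj U (Matrix.of fun i j => (tiltedMean α (r i) (r j) : ℂ) * B i j) := by
  obtain ⟨U, r, rfl⟩ := exists_eq_unitaryDiag hρ.isHermitian
  have hr := (posSemidef_unitaryDiag_iff U).1 hρ
  exact ⟨U, r, hr, fun α B => tiltedKuboMori_unitaryDiag U α hr B⟩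

theorem tiltedKuboMori_add (hρ : ρ.PosSemidef) (α : ℝ) (A B : Matrix n n ℂ) :
    tiltedKuboMori α ρ (A + B) = tiltedKuboMori α ρ A + tiltedKuboMori α ρ B := by
  obtain ⟨U, r, -, hT⟩ := exists_tiltedKuboMori_eq hρ
  obtain ⟨A, rfl⟩ := unitaryConj_surjective U A
  obtain ⟨B, rfl⟩ := unitaryConj_surjective U B
  simp only [← map_add, hT, Matrix.add_apply, mul_add]
  rfl

theorem tiltedKuboMori_smul (hρ : ρ.PosSemidef) (α : ℝ) (c : ℂ) (A : Matrix n n ℂ) :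
    tiltedKuboMori α ρ (c • A) = c • tiltedKuboMori α ρ A := by
  obtain ⟨U, r, -, hT⟩ := exists_tiltedKuboMori_eq hρ
  obtain ⟨A, rfl⟩ := unitaryConj_surjective U A
  simp only [← map_smul, hT, Matrix.smul_apply, smul_eq_mul, mul_left_comm]
  rfl

theorem tiltedKuboMori_conjTranspose (hρ : ρ.PosSemidef) (α : ℝ) (A : Matrix n n ℂ) :
    (tiltedKuboMori α ρ A)ᴴ = tiltedKuboMori (-α) ρ Aᴴ := by
  obtain ⟨U, r, -, hT⟩ := exists_tiltedKuboMori_eq hρ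
  obtain ⟨A, rfl⟩ := unitaryConj_surjective U A
  simp only [← Matrix.star_eq_conjTranspose, ← map_star, hT]
  congr 1
  ext i j
  simp [tiltedMean_neg]

theorem hs_tiltedKuboMori (hρ : ρ.PosSemidef) (α : ℝ) (A B : Matrix n n ℂ) :
    hs A (tiltedKuboMori α ρ B) = hs (tiltedKuboMori α ρ A) B := by
  obtain ⟨U, r, -, hT⟩ := exists_tiltedKuboMori_eq hρ
  obtain ⟨A, rfl⟩ := unitaryConj_surjective U A
  obtain ⟨B, rfl⟩ := unitaryConj_surjective U B
  rw [hT, hT, hs_unitaryConj, hs_unitaryConj, hs_eq_sum, hs_eq_sum]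
  simp [mul_left_comm, mul_assoc]

theorem hs_tiltedKuboMori_self_nonneg (hρ : ρ.PosSemidef) (α : ℝ) (A : Matrix n n ℂ) :
    0 ≤ (hs A (tiltedKuboMori α ρ A)).re := by
  obtain ⟨U, r, hr, hT⟩ := exists_tiltedKuboMori_eq hρ
  obtain ⟨A, rfl⟩ := unitaryConj_surjective U A
  rw [hT, hs_unitaryConj, hs_eq_sum]
  simp only [Complex.re_sum, Matrix.of_apply]
  refine Finset.sum_nonneg fun i _ => Finset.sum_nonneg fun j _ => ?_
  rw [mul_left_comm, Complex.star_def, ← Complex.normSq_eq_conj_mul_self, ← Complex.ofReal_mul,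
    Complex.ofReal_re]
  exact mul_nonneg (tiltedMean_nonneg _ (hr i) (hr j)) (Complex.normSq_nonneg _)

theorem tiltedKuboMori_lie_mlog (hρ : ρ.PosDef) (α : ℝ) (Q : Matrix n n ℂ) :
    tiltedKuboMori α ρ (⁅Q, mlog ρ⁆ - α • Q) =
      Real.exp (-α / 2) • (Q * ρ) - Real.exp (α / 2) • (ρ * Q) := by
  obtain ⟨U, r, rfl⟩ := exists_eq_unitaryDiag hρ.isHermitian
  have hr := (posDef_unitaryDiag_iff U).1 hρ
  obtain ⟨Q, rfl⟩ := unitaryConj_surjective U Q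
  rw [mlog_unitaryDiag]
  simp only [unitaryDiag_apply, Ring.lie_def, ← map_mul, ← map_sub, ← Complex.coe_smul,
    ← map_smul]
  rw [← unitaryDiag_apply, tiltedKuboMori_unitaryDiag U α fun i => (hr i).le]
  congr 1
  ext i j
  have h := congrArg (fun x : ℝ => (x : ℂ)) (tiltedMean_mul_log α (hr i) (hr j))
  simp only [Complex.ofReal_mul, Complex.ofReal_sub, Complex.ofReal_add] at h
  simp only [Matrix.of_apply, Matrix.sub_apply, Matrix.smul_apply, Matrix.mul_diagonal,
    Matrix.diagonal_mul, smul_eq_mul]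
  linear_combination (-(Q i j)) * h

end KuboMori

section Sandwich

variable {n : Type*} [Fintype n] [DecidableEq n] {τ : Matrix n n ℂ}

/-- The operator `X ↦ [Q*, D^α_τ [Q, X]]`, the common building block of the Onsager operators. -/
def sandwich (α : ℝ) (Q τ X : Matrix n n ℂ) : Matrix n n ℂ :=
  ⁅Qᴴ, tiltedKuboMori α τ ⁅Q, X⁆⁆

theorem sandwich_add (hτ : τ.PosSemidef) (α : ℝ) (Q X Y : Matrix n n ℂ) :
    sandwich α Q τ (X + Y) = sandwich α Q τ X + sandwich α Q τ Y := by
  simp only [sandwich, bracket_add, tiltedKuboMori_add hτ]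

theorem sandwich_smul (hτ : τ.PosSemidef) (α : ℝ) (c : ℂ) (Q X : Matrix n n ℂ) :
    sandwich α Q τ (c • X) = c • sandwich α Q τ X := by
  simp only [sandwich, bracket_smul, tiltedKuboMori_smul hτ]

theorem sandwich_one (hτ : τ.PosSemidef) (α : ℝ) (Q : Matrix n n ℂ) :
    sandwich α Q τ 1 = 0 := by
  have hzero : tiltedKuboMori α τ 0 = 0 := by simpa using tiltedKuboMori_smul hτ α 0 0
  rw [sandwich, Ring.lie_def Q, Matrix.mul_one, Matrix.one_mul, sub_self, hzero, Ring.lie_def,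
    Matrix.mul_zero, Matrix.zero_mul, sub_self]

theorem sandwich_conjTranspose (hτ : τ.PosSemidef) (α : ℝ) (Q X : Matrix n n ℂ) :
    (sandwich α Q τ X)ᴴ = sandwich (-α) Qᴴ τ Xᴴ := by
  rw [sandwich, sandwich, conjTranspose_lie, tiltedKuboMori_conjTranspose hτ, conjTranspose_lie,
    ← neg_bracket, ← neg_bracket Qᴴ, ← neg_one_smul ℂ ⁅Qᴴ, Xᴴ⁆, tiltedKuboMori_smul hτ,
    bracket_smul, neg_one_smul, neg_neg]

theorem hs_sandwich (hτ : τ.PosSemidef) (α : ℝ) (Q X Y : Matrix n n ℂ) :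
    hs (sandwich α Q τ X) Y = hs X (sandwich α Q τ Y) := by
  rw [← star_hs Y, sandwich, sandwich, hs_conjTranspose_lie, hs_conjTranspose_lie, star_hs,
    hs_tiltedKuboMori hτ]

theorem hs_sandwich_self_nonneg (hτ : τ.PosSemidef) (α : ℝ) (Q X : Matrix n n ℂ) :
    0 ≤ (hs X (sandwich α Q τ X)).re := by
  rw [sandwich, hs_conjTranspose_lie]
  exact hs_tiltedKuboMori_self_nonneg hτ _ _

end Sandwich

section Overlap

variable {n : Type*} [Fintype n] [DecidableEq n] (U W : Matrix.unitaryGroup n ℂ)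

/-- The transition probabilities `|⟨u i, w j⟩|²` between the orthonormal bases of columns of `U` and
of `W`. They reduce traces of products of two operators to inequalities between their
eigenvalues. -/
def overlap : Matrix n n ℝ :=
  Matrix.of fun i j => Complex.normSq ((U⁻¹ * W : Matrix.unitaryGroup n ℂ) i j)

theorem sum_normSq_apply (V : Matrix.unitaryGroup n ℂ) (i : n) :
    ∑ j, Complex.normSq (V i j) = 1 := by
  have h : ((V : Matrix n n ℂ) * star (V : Matrix n n ℂ)) i i = (1 : Matrix n n ℂ) i i := by
    rw [Unitary.mul_star_self_of_mem V.2]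
  simp only [Matrix.mul_apply, Matrix.star_apply, Complex.star_def, Complex.mul_conj,
    Matrix.one_apply_eq] at h
  exact_mod_cast h

theorem transpose_overlap : (overlap U W)ᵀ = overlap W U := by
  have h : (U⁻¹ * W)⁻¹ = W⁻¹ * U := by group
  ext j i
  rw [Matrix.transpose_apply, overlap, overlap, Matrix.of_apply, Matrix.of_apply, ← h,
    Matrix.UnitaryGroup.inv_apply, Matrix.star_apply, Complex.star_def, Complex.normSq_conj]

theorem overlap_mem_doublyStochastic : overlap U W ∈ doublyStochastic ℝ n := by
  refine mem_doublyStochastic_iff_sum.2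
    ⟨fun _ _ => Complex.normSq_nonneg _, fun i => sum_normSq_apply _ i, fun j => ?_⟩
  simp only [← Matrix.transpose_apply (overlap U W), transpose_overlap]
  exact sum_normSq_apply _ j

theorem re_trace_unitaryDiag_mul (a c : n → ℝ) :
    (unitaryDiag U a * unitaryDiag W c).trace.re =
      ∑ i, ∑ j, overlap U W i j * (a i * c j) := by
  let V : Matrix n n ℂ := (U : Matrix n n ℂ)ᴴ * W
  have h : (unitaryDiag U a * unitaryDiag W c).trace =
      ((Matrix.diagonal fun i => (a i : ℂ)) *
        (V * (Matrix.diagonal fun i => (c i : ℂ)) * Vᴴ)).trace := by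
    rw [unitaryDiag_apply, unitaryDiag_apply, unitaryConj_apply, unitaryConj_apply,
      Matrix.mul_assoc (U : Matrix n n ℂ), Matrix.mul_assoc (U : Matrix n n ℂ),
      Matrix.trace_mul_comm]
    simp only [V, Matrix.conjTranspose_mul, Matrix.conjTranspose_conjTranspose, Matrix.mul_assoc]
  rw [h, Matrix.trace, Complex.re_sum]
  refine Finset.sum_congr rfl fun i _ => ?_
  rw [Matrix.diag_apply, Matrix.diagonal_mul, Matrix.mul_apply, Finset.mul_sum, Complex.re_sum]
  refine Finset.sum_congr rfl fun j _ => ?_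
  rw [Matrix.mul_diagonal, Matrix.conjTranspose_apply, mul_right_comm, Complex.star_def,
    Complex.mul_conj, ← Complex.ofReal_mul, ← Complex.ofReal_mul, Complex.ofReal_re]
  change _ = Complex.normSq (V i j) * _
  ring

theorem sum_overlap_mul_left (a : n → ℝ) :
    ∑ i, ∑ j, overlap U W i j * a i = ∑ i, a i := by
  simp only [← Finset.sum_mul, sum_row_of_mem_doublyStochastic (overlap_mem_doublyStochastic U W),
    one_mul]

theorem sum_overlap_mul_right (b : n → ℝ) :
    ∑ i, ∑ j, overlap U W i j * b j = ∑ j, b j := by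
  rw [Finset.sum_comm]
  simp only [← Finset.sum_mul, sum_col_of_mem_doublyStochastic (overlap_mem_doublyStochastic U W),
    one_mul]

end Overlap

section RelativeEntropy

theorem sub_le_mul_log_sub_log {a b : ℝ} (ha : 0 ≤ a) (hb : 0 < b) :
    a - b ≤ a * (Real.log a - Real.log b) := by
  rcases ha.eq_or_lt with rfl | ha
  · simpa using hb.le
  · have h := mul_le_mul_of_nonneg_left (Real.one_sub_inv_le_log_of_pos (div_pos ha hb)) ha.le
    rwa [Real.log_div ha.ne' hb.ne', inv_div, mul_sub, mul_one, mul_div_cancel₀ b ha.ne'] at h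

theorem mul_log_sub_log_le {a b : ℝ} (ha : 0 ≤ a) (hb : 0 < b) :
    a * (Real.log a - Real.log b) ≤ a * a * b⁻¹ - a := by
  rcases ha.eq_or_lt with rfl | ha
  · simp
  · have h := mul_le_mul_of_nonneg_left (Real.log_le_sub_one_of_pos (div_pos ha hb)) ha.le
    rwa [Real.log_div ha.ne' hb.ne', mul_sub_one, div_eq_mul_inv, ← mul_assoc] at h

variable {n : Type*} [Fintype n] [DecidableEq n]

theorem relEntropy_unitaryDiag (U W : Matrix.unitaryGroup n ℂ) (a b : n → ℝ) :
    relEntropy (unitaryDiag W b) (unitaryDiag U a) =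
      ∑ i, ∑ j, overlap U W i j * (a i * (Real.log (a i) - Real.log (b j))) := by
  rw [relEntropy, mlog_unitaryDiag, mlog_unitaryDiag, Matrix.mul_sub, Matrix.trace_sub,
    Complex.sub_re, ← map_mul, trace_unitaryDiag, re_trace_unitaryDiag_mul, Complex.ofReal_re,
    ← sum_overlap_mul_left U W]
  simp only [← Finset.sum_sub_distrib, ← mul_sub, Pi.mul_apply]

theorem re_trace_sub_le_relEntropy {A B : Matrix n n ℂ} (hA : A.PosSemidef) (hB : B.PosDef) :
    A.trace.re - B.trace.re ≤ relEntropy B A := by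
  obtain ⟨U, a, rfl⟩ := exists_eq_unitaryDiag hA.isHermitian
  obtain ⟨W, b, rfl⟩ := exists_eq_unitaryDiag hB.isHermitian
  rw [relEntropy_unitaryDiag, trace_unitaryDiag, trace_unitaryDiag, Complex.ofReal_re,
    Complex.ofReal_re, ← sum_overlap_mul_left U W a, ← sum_overlap_mul_right U W b]
  simp only [← Finset.sum_sub_distrib, ← mul_sub]
  exact Finset.sum_le_sum fun i _ => Finset.sum_le_sum fun j _ => mul_le_mul_of_nonneg_left
    (sub_le_mul_log_sub_log ((posSemidef_unitaryDiag_iff U).1 hA i)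
      ((posDef_unitaryDiag_iff W).1 hB j)) (Complex.normSq_nonneg _)

theorem relEntropy_le {A B : Matrix n n ℂ} (hA : A.PosSemidef) (hB : B.PosDef) :
    relEntropy B A ≤ (A * A * B⁻¹).trace.re - A.trace.re := by
  obtain ⟨U, a, rfl⟩ := exists_eq_unitaryDiag hA.isHermitian
  obtain ⟨W, b, rfl⟩ := exists_eq_unitaryDiag hB.isHermitian
  have hb := (posDef_unitaryDiag_iff W).1 hB
  rw [relEntropy_unitaryDiag, inv_unitaryDiag W fun i => (hb i).ne', ← map_mul,
    re_trace_unitaryDiag_mul, trace_unitaryDiag, Complex.ofReal_re, ← sum_overlap_mul_left U W a]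
  simp only [← Finset.sum_sub_distrib, ← mul_sub]
  exact Finset.sum_le_sum fun i _ => Finset.sum_le_sum fun j _ => mul_le_mul_of_nonneg_left
    (mul_log_sub_log_le ((posSemidef_unitaryDiag_iff U).1 hA i) (hb j)) (Complex.normSq_nonneg _)

theorem exists_posSemidef_sub_smul_one {n : Type*} [Finite n] [DecidableEq n] {ρ : Matrix n n ℂ}
    (hρ : ρ.PosDef) : ∃ c : ℝ, 0 < c ∧ (ρ - c • 1).PosSemidef := by
  have := Fintype.ofFinite n
  obtain ⟨U, r, rfl⟩ := exists_eq_unitaryDiag hρ.isHermitian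
  have hr := (posDef_unitaryDiag_iff U).1 hρ
  obtain ⟨c, hc, hcr⟩ : ∃ c : ℝ, 0 < c ∧ ∀ i, c ≤ r i := by
    rcases isEmpty_or_nonempty n with hn | hn
    · exact ⟨1, one_pos, fun i => hn.elim i⟩
    · obtain ⟨i, hi⟩ := Finite.exists_min r
      exact ⟨r i, hr i, hi⟩
  refine ⟨c, hc, ?_⟩
  rw [← map_one (unitaryDiag U), ← map_smul, ← map_sub, posSemidef_unitaryDiag_iff]
  intro i
  simpa using hcr i

theorem eventually_posSemidef_smul_one_add_smul {n : Type*} [Finite n] [DecidableEq n] {c : ℝ}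
    (hc : 0 < c) {v : Matrix n n ℂ} (hv : v.IsHermitian) :
    ∀ᶠ t : ℝ in nhds 0, (c • (1 : Matrix n n ℂ) + t • v).PosSemidef := by
  have := Fintype.ofFinite n
  obtain ⟨W, w, rfl⟩ := exists_eq_unitaryDiag hv
  have hpos (i : n) : ∀ᶠ t : ℝ in nhds 0, 0 ≤ c + t * w i := by
    have h : Filter.Tendsto (fun t : ℝ => c + t * w i) (nhds 0) (nhds (c + 0 * w i)) :=
      Continuous.tendsto (by fun_prop) 0
    rw [zero_mul, add_zero] at h
    exact h.eventually (eventually_ge_nhds hc)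
  filter_upwards [Filter.eventually_all.2 hpos] with t ht
  rw [← map_one (unitaryDiag W), ← map_smul, ← map_smul, ← map_add, posSemidef_unitaryDiag_iff]
  simpa using ht

theorem eventually_posSemidef_add_smul {n : Type*} [Finite n] {ρ v : Matrix n n ℂ}
    (hρ : ρ.PosDef) (hv : v.IsHermitian) : ∀ᶠ t : ℝ in nhds 0, (ρ + t • v).PosSemidef := by
  classical
  obtain ⟨c, hc, hρc⟩ := exists_posSemidef_sub_smul_one hρ
  filter_upwards [eventually_posSemidef_smul_one_add_smul hc hv] with t ht
  simpa only [← add_assoc, sub_add_cancel] using hρc.add ht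

-- The relative entropy `Tr (A (log A - log ρ))` lies between `Tr A - Tr ρ = 0` and
-- `Tr (A² ρ⁻¹) - Tr A = t² Tr (v² ρ⁻¹)` for `A = ρ + t v`.
theorem hasDerivAt_relEntropy_self {ρ v : Matrix n n ℂ} (hρ : ρ.PosDef) (hv : v.IsHermitian)
    (htr : v.trace = 0) : HasDerivAt (fun t : ℝ => relEntropy ρ (ρ + t • v)) 0 0 := by
  have hdet : IsUnit ρ.det := (Matrix.isUnit_iff_isUnit_det _).1 hρ.isUnit
  have htrace (t : ℝ) : (ρ + t • v).trace = ρ.trace := by simp [htr]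
  have htrace_sq (t : ℝ) : ((ρ + t • v) * (ρ + t • v) * ρ⁻¹).trace =
      ρ.trace + (t ^ 2 : ℝ) • (v * v * ρ⁻¹).trace := by
    have hρv : (ρ * v * ρ⁻¹).trace = 0 := by
      rw [Matrix.trace_mul_cycle, Matrix.nonsing_inv_mul _ hdet, Matrix.one_mul, htr]
    simp only [add_mul, mul_add, Matrix.trace_add, Matrix.smul_mul, Matrix.mul_smul,
      Matrix.trace_smul, hρv, Matrix.mul_assoc v ρ, Matrix.mul_assoc ρ ρ,
      Matrix.mul_nonsing_inv _ hdet, Matrix.mul_one, htr, smul_zero, add_zero, zero_add,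
      smul_smul, pow_two]
  have hO : (fun t : ℝ => relEntropy ρ (ρ + t • v)) =O[nhds 0] fun t => ‖t - 0‖ ^ 2 := by
    refine Asymptotics.IsBigO.of_bound |(v * v * ρ⁻¹).trace.re| ?_
    filter_upwards [eventually_posSemidef_add_smul hρ hv] with t ht
    have hlower := re_trace_sub_le_relEntropy ht hρ
    have hupper := relEntropy_le ht hρ
    rw [htrace, sub_self] at hlower
    rw [htrace, htrace_sq, Complex.add_re, add_sub_cancel_left, Complex.smul_re,
      smul_eq_mul] at hupper
    rw [Real.norm_of_nonneg hlower, sub_zero, norm_pow, norm_norm, Real.norm_eq_abs, sq_abs,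
      mul_comm]
    exact hupper.trans (mul_le_mul_of_nonneg_left (le_abs_self _) (sq_nonneg t))
  simpa using (hO.hasFDerivAt (by norm_num)).hasDerivAt

theorem relEntropy_eq_add (ρ σ A : Matrix n n ℂ) :
    relEntropy σ A = relEntropy ρ A + ((mlog ρ - mlog σ) * A).trace.re := by
  rw [relEntropy, relEntropy, Matrix.trace_mul_comm _ A, ← Complex.add_re, ← Matrix.trace_add,
    ← Matrix.mul_add, sub_add_sub_cancel]

theorem hasDerivAt_relEntropy {ρ v : Matrix n n ℂ} (hρ : ρ.PosDef) (hv : v.IsHermitian)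
    (htr : v.trace = 0) (σ : Matrix n n ℂ) :
    HasDerivAt (fun t : ℝ => relEntropy σ (ρ + t • v)) ((mlog ρ - mlog σ) * v).trace.re 0 := by
  have hlinear : HasDerivAt (fun t : ℝ => ((mlog ρ - mlog σ) * (ρ + t • v)).trace.re)
      ((mlog ρ - mlog σ) * v).trace.re 0 := by
    simpa [Matrix.mul_add] using ((hasDerivAt_id (0 : ℝ)).mul_const
      ((mlog ρ - mlog σ) * v).trace.re).const_add ((mlog ρ - mlog σ) * ρ).trace.re
  simpa only [relEntropy_eq_add ρ σ, zero_add] using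
    (hasDerivAt_relEntropy_self hρ hv htr).fun_add hlinear

theorem isHermitian_mlog {ρ : Matrix n n ℂ} (hρ : ρ.IsHermitian) : (mlog ρ).IsHermitian := by
  obtain ⟨U, r, rfl⟩ := exists_eq_unitaryDiag hρ
  rw [mlog_unitaryDiag]
  exact isHermitian_unitaryDiag _ _

theorem isDifferentialAt_relEntropy {H ρ : Matrix n n ℂ} (hH : H.IsHermitian) (β : ℝ)
    (hρ : ρ.PosDef) : IsDifferentialAt (relEntropy (gibbs β H)) ρ (mlog ρ + β • H) := by
  refine ⟨(isHermitian_mlog hρ.isHermitian).add (hH.smul (by simp [IsSelfAdjoint])),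
    fun v hv htr => ?_⟩
  obtain ⟨c, hc⟩ := exists_mlog_gibbs_eq hH β
  have htrace : ((mlog ρ - mlog (gibbs β H)) * v).trace = ((mlog ρ + β • H) * v).trace := by
    rw [hc, ← sub_add, sub_neg_eq_add, add_mul, Matrix.trace_add, Matrix.smul_mul,
      Matrix.one_mul, Matrix.trace_smul, htr, smul_zero, add_zero]
  rw [← htrace]
  exact hasDerivAt_relEntropy hρ hv htr (gibbs β H)

end RelativeEntropy

section EntropicGradient

variable {n : Type*} [Fintype n] [DecidableEq n]

theorem exists_eq_smul_one_of_trace_mul_eq_zero {D : Matrix n n ℂ} (hD : D.IsHermitian)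
    (h : ∀ v : Matrix n n ℂ, v.IsHermitian → v.trace = 0 → (D * v).trace.re = 0) :
    ∃ c : ℂ, D = c • 1 := by
  rcases isEmpty_or_nonempty n with hn | hn
  · exact ⟨0, Subsingleton.elim _ _⟩
  let c : ℂ := D.trace / Fintype.card n
  have hc : star c = c := by
    simp only [c, star_div₀, star_natCast, ← Matrix.trace_conjTranspose, hD.eq]
  have hherm : (D - c • 1).IsHermitian := by
    rw [Matrix.IsHermitian, Matrix.conjTranspose_sub, hD.eq, Matrix.conjTranspose_smul, hc,
      Matrix.conjTranspose_one]
  have htr : (D - c • 1).trace = 0 := by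
    rw [Matrix.trace_sub, Matrix.trace_smul, Matrix.trace_one, smul_eq_mul,
      div_mul_cancel₀ _ (Nat.cast_ne_zero.2 Fintype.card_ne_zero), sub_self]
  have hre : (hs (D - c • 1) (D - c • 1)).re = 0 := by
    rw [hs, hherm.eq, Matrix.sub_mul, Matrix.smul_mul, Matrix.one_mul, Matrix.trace_sub,
      Matrix.trace_smul, htr, smul_zero, sub_zero, h _ hherm htr]
  have him : (hs (D - c • 1) (D - c • 1)).im = 0 := Complex.conj_eq_iff_im.1 (star_hs _ _)
  exact ⟨c, sub_eq_zero.1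
    (Matrix.trace_conjTranspose_mul_self_eq_zero_iff.1 (Complex.ext hre him))⟩

theorem IsDifferentialAt.exists_sub_eq_smul_one {F : Matrix n n ℂ → ℝ} {ρ G G' : Matrix n n ℂ}
    (hG : IsDifferentialAt F ρ G) (hG' : IsDifferentialAt F ρ G') : ∃ c : ℂ, G - G' = c • 1 := by
  refine exists_eq_smul_one_of_trace_mul_eq_zero (hG.1.sub hG'.1) fun v hv htr => ?_
  rw [Matrix.sub_mul, Matrix.trace_sub, Complex.sub_re,
    (hG.2 v hv htr).unique (hG'.2 v hv htr), sub_self]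

theorem isEntropicGradient_of_isOnsager {H : Matrix n n ℂ} (hH : H.IsHermitian) (β : ℝ)
    {L : Matrix n n ℂ →ₗ[ℂ] Matrix n n ℂ} {K : Matrix n n ℂ → Matrix n n ℂ → Matrix n n ℂ}
    (hK : IsOnsager K) (hone : ∀ ρ, IsDensity ρ → K ρ 1 = 0)
    (hL : ∀ ρ, ρ.PosDef → L ρ = -K ρ (mlog ρ + β • H)) : IsEntropicGradient β H L K := by
  intro ρ hdens hpos
  have hdiff := isDifferentialAt_relEntropy hH β hpos
  refine ⟨hdiff, hL ρ hpos, fun G hG => ?_⟩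
  obtain ⟨c, hc⟩ := hG.exists_sub_eq_smul_one hdiff
  rw [eq_add_of_sub_eq' hc, (hK ρ hdens).1.map_add, (hK ρ hdens).1.map_smul, hone ρ hdens,
    smul_zero, add_zero, hL ρ hpos]

end EntropicGradient

section PartialTrace

variable {n m : Type*} [Fintype m]

theorem trSnd_add (X Y : Matrix (n × m) (n × m) ℂ) : trSnd (X + Y) = trSnd X + trSnd Y := by
  ext i j
  simp [trSnd, Finset.sum_add_distrib]

theorem trSnd_smul (c : ℂ) (X : Matrix (n × m) (n × m) ℂ) : trSnd (c • X) = c • trSnd X := by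
  ext i j
  simp [trSnd, Finset.mul_sum]

theorem trSnd_conjTranspose (X : Matrix (n × m) (n × m) ℂ) : (trSnd X)ᴴ = trSnd Xᴴ := by
  ext i j
  simp [trSnd]

variable [Fintype n]

theorem trace_trSnd (X : Matrix (n × m) (n × m) ℂ) : (trSnd X).trace = X.trace := by
  simp [Matrix.trace, trSnd, Fintype.sum_prod_type]

variable [DecidableEq m]

theorem trSnd_kronecker_one_mul (A : Matrix n n ℂ) (X : Matrix (n × m) (n × m) ℂ) :
    trSnd ((A ⊗ₖ (1 : Matrix m m ℂ)) * X) = A * trSnd X := by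
  ext i j
  simp only [trSnd, Matrix.of_apply, Matrix.mul_apply, Fintype.sum_prod_type,
    Matrix.kronecker_apply, Matrix.one_apply, mul_ite, mul_one, mul_zero, ite_mul, zero_mul,
    Finset.sum_ite_eq, Finset.mem_univ, if_true, Finset.mul_sum]
  exact Finset.sum_comm

theorem hs_trSnd (ξ : Matrix n n ℂ) (X : Matrix (n × m) (n × m) ℂ) :
    hs ξ (trSnd X) = hs (ξ ⊗ₖ (1 : Matrix m m ℂ)) X := by
  rw [hs, hs, Matrix.conjTranspose_kronecker, Matrix.conjTranspose_one, ← trace_trSnd,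
    trSnd_kronecker_one_mul]

end PartialTrace

section TensorOnsager

variable {n m : Type*} [Fintype n] [DecidableEq n] [Fintype m] [DecidableEq m]
  {Q : Matrix (n × m) (n × m) ℂ} {τ : Matrix m m ℂ}

theorem tensorOnsager_eq_trSnd_sandwich (hQ : Q.IsHermitian) (τ : Matrix m m ℂ)
    (ρ ξ : Matrix n n ℂ) :
    tensorOnsager Q τ ρ ξ = trSnd (sandwich 0 Q (ρ ⊗ₖ τ) (ξ ⊗ₖ (1 : Matrix m m ℂ))) := by
  rw [tensorOnsager, sandwich, hQ.eq, kuboMori_eq_tiltedKuboMori_zero]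

theorem isOnsager_tensorOnsager (hQ : Q.IsHermitian) (hτ : τ.PosSemidef) :
    IsOnsager (tensorOnsager (n := n) Q τ) := by
  intro ρ hρ
  have hρτ : (ρ ⊗ₖ τ).PosSemidef := hρ.1.kronecker hτ
  have hK := tensorOnsager_eq_trSnd_sandwich hQ τ ρ
  refine ⟨⟨fun ξ η => ?_, fun c ξ => ?_⟩, fun ξ hξ => ?_, fun ξ η => ?_, fun ξ => ?_⟩
  · rw [hK, hK, hK, Matrix.add_kronecker, sandwich_add hρτ, trSnd_add]
  · rw [hK, hK, Matrix.smul_kronecker, sandwich_smul hρτ, trSnd_smul]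
  · rw [hK, Matrix.IsHermitian, trSnd_conjTranspose, sandwich_conjTranspose hρτ, neg_zero, hQ.eq,
      Matrix.conjTranspose_kronecker, hξ.eq, Matrix.conjTranspose_one]
  · rw [hK, hK, ← star_hs η, hs_trSnd, hs_trSnd, star_hs, hs_sandwich hρτ]
  · rw [hK, hs_trSnd]
    exact hs_sandwich_self_nonneg hρτ _ _ _

theorem mlog_kronecker {ρ : Matrix n n ℂ} (hρ : ρ.PosDef) (hτ : τ.PosDef) :
    mlog (ρ ⊗ₖ τ) = mlog ρ ⊗ₖ (1 : Matrix m m ℂ) + (1 : Matrix n n ℂ) ⊗ₖ mlog τ := by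
  obtain ⟨U, r, rfl⟩ := exists_eq_unitaryDiag hρ.isHermitian
  obtain ⟨V, s, rfl⟩ := exists_eq_unitaryDiag hτ.isHermitian
  have hr := (posDef_unitaryDiag_iff U).1 hρ
  have hs := (posDef_unitaryDiag_iff V).1 hτ
  rw [unitaryDiag_kronecker, mlog_unitaryDiag, mlog_unitaryDiag, mlog_unitaryDiag,
    ← map_one (unitaryDiag U), ← map_one (unitaryDiag V), unitaryDiag_kronecker,
    unitaryDiag_kronecker, ← map_add]
  congr 1
  ext x
  simp [Real.log_mul (hr _).ne' (hs _).ne']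

theorem bracket_mlog_eq_zero {A B : Matrix n n ℂ} (h : ⁅A, B⁆ = 0) : ⁅A, mlog B⁆ = 0 :=
  sub_eq_zero.2 (Commute.cfc_real (f := Real.log) (sub_eq_zero.1 h).symm).symm

theorem bracket_kronecker_one_eq_bracket_mlog {H : Matrix n n ℂ} (hH : H.IsHermitian) (β : ℝ)
    (hτ : τ.PosDef) (hcomm : ⁅Q, gibbs β H ⊗ₖ τ⁆ = 0) {ρ : Matrix n n ℂ} (hρ : ρ.PosDef) :
    ⁅Q, (mlog ρ + β • H) ⊗ₖ (1 : Matrix m m ℂ)⁆ = ⁅Q, mlog (ρ ⊗ₖ τ)⁆ := by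
  obtain ⟨c, hc⟩ := exists_mlog_gibbs_eq hH β
  have hsplit : (mlog ρ + β • H) ⊗ₖ (1 : Matrix m m ℂ) =
      mlog (ρ ⊗ₖ τ) - mlog (gibbs β H ⊗ₖ τ) - c • 1 := by
    rw [mlog_kronecker hρ hτ, mlog_kronecker (posDef_gibbs hH β) hτ, hc, add_sub_add_right_eq_sub]
    rw [← Matrix.one_kronecker_one (α := ℂ) (m := n) (n := m)]
    ext x y
    simp only [Matrix.kroneckerMap_apply, Matrix.add_apply, Matrix.sub_apply, Matrix.neg_apply,
      Matrix.smul_apply, Complex.real_smul]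
    ring
  rw [hsplit, bracket_sub, bracket_sub, bracket_mlog_eq_zero hcomm, bracket_smul, Ring.lie_def Q 1,
    mul_one, one_mul, sub_self, smul_zero, sub_zero, sub_zero]

theorem neg_tensorOnsager_mlog_add {H : Matrix n n ℂ} (hH : H.IsHermitian) (β : ℝ)
    (hτ : τ.PosDef) (hcomm : ⁅Q, gibbs β H ⊗ₖ τ⁆ = 0) {ρ : Matrix n n ℂ} (hρ : ρ.PosDef) :
    -tensorOnsager Q τ ρ (mlog ρ + β • H) = tensorLindblad Q τ ρ := by
  have h := tiltedKuboMori_lie_mlog (hρ.kronecker hτ) 0 Q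
  rw [zero_smul, sub_zero, neg_zero, zero_div, Real.exp_zero, one_smul, one_smul] at h
  rw [tensorOnsager, tensorLindblad, bracket_kronecker_one_eq_bracket_mlog hH β hτ hcomm hρ,
    kuboMori_eq_tiltedKuboMori_zero, h, ← Ring.lie_def]

theorem isEntropicGradient_tensorOnsager {H : Matrix n n ℂ} (hH : H.IsHermitian) (β : ℝ)
    {L : Matrix n n ℂ →ₗ[ℂ] Matrix n n ℂ} (hQ : Q.IsHermitian) (hτ : τ.PosDef)
    (hcomm : ⁅Q, gibbs β H ⊗ₖ τ⁆ = 0) (hL : ∀ A, L A = tensorLindblad Q τ A) :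
    IsEntropicGradient β H L (tensorOnsager Q τ) := by
  refine isEntropicGradient_of_isOnsager hH β (isOnsager_tensorOnsager hQ hτ.posSemidef)
    (fun ρ hρ => ?_) fun ρ hρ => ?_
  · rw [tensorOnsager_eq_trSnd_sandwich hQ, Matrix.one_kronecker_one,
      sandwich_one (hρ.1.kronecker hτ.posSemidef), ← zero_smul ℂ (0 : Matrix (n × m) (n × m) ℂ),
      trSnd_smul, zero_smul]
  · rw [hL, neg_tensorOnsager_mlog_add hH β hτ hcomm hρ]

end TensorOnsager

section Eigenpair

variable {n : Type*} [Fintype n] {H Q R : Matrix n n ℂ} {ω ν : ℝ}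

theorem IsEigenpair.conjTranspose (hH : H.IsHermitian) (hQ : IsEigenpair H ω Q) :
    IsEigenpair H (-ω) Qᴴ := by
  have h := congrArg Matrix.conjTranspose hQ
  rwa [conjTranspose_lie, hH.eq, Matrix.conjTranspose_smul, star_trivial, ← neg_bracket,
    neg_eq_iff_eq_neg, ← neg_smul] at h

theorem IsEigenpair.mul (hQ : IsEigenpair H ω Q) (hR : IsEigenpair H ν R) :
    IsEigenpair H (ω + ν) (Q * R) := by
  rw [IsEigenpair, Ring.lie_def, sub_eq_iff_eq_add] at *
  rw [Matrix.mul_assoc, hR, Matrix.mul_add, ← Matrix.mul_assoc, hQ, Matrix.add_mul,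
    Matrix.mul_smul, Matrix.smul_mul, Matrix.mul_assoc, add_smul]
  abel

theorem IsEigenpair.smul (hQ : IsEigenpair H ω Q) (c : ℂ) : IsEigenpair H ω (c • Q) := by
  rw [IsEigenpair, smul_bracket, hQ, smul_comm]

end Eigenpair

section BlockOnsager

variable {n : Type*} [Fintype n] [DecidableEq n]

theorem blockOnsager_eq_sandwich_add (β ω : ℝ) (Q ρ ξ : Matrix n n ℂ) :
    blockOnsager β ω Q ρ ξ = sandwich (-(β * ω)) Q ρ ξ + sandwich (β * ω) Qᴴ ρ ξ := by
  rw [blockOnsager, sandwich, sandwich, Matrix.conjTranspose_conjTranspose]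

theorem isOnsager_blockOnsager (β ω : ℝ) (Q : Matrix n n ℂ) : IsOnsager (blockOnsager β ω Q) := by
  intro ρ hρ
  have hK := blockOnsager_eq_sandwich_add β ω Q ρ
  refine ⟨⟨fun ξ η => ?_, fun c ξ => ?_⟩, fun ξ hξ => ?_, fun ξ η => ?_, fun ξ => ?_⟩
  · rw [hK, hK, hK, sandwich_add hρ.1, sandwich_add hρ.1, add_add_add_comm]
  · rw [hK, hK, sandwich_smul hρ.1, sandwich_smul hρ.1, smul_add]
  · rw [hK, Matrix.IsHermitian, Matrix.conjTranspose_add, sandwich_conjTranspose hρ.1,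
      sandwich_conjTranspose hρ.1, hξ.eq, neg_neg, Matrix.conjTranspose_conjTranspose, add_comm]
  · rw [hK, hK, hs_add_left, hs_add_right, hs_sandwich hρ.1, hs_sandwich hρ.1]
  · rw [hK, hs_add_right, Complex.add_re]
    exact add_nonneg (hs_sandwich_self_nonneg hρ.1 _ _ _) (hs_sandwich_self_nonneg hρ.1 _ _ _)

theorem isOnsager_sum {n ι : Type*} [Fintype n] [Fintype ι]
    {K : ι → Matrix n n ℂ → Matrix n n ℂ → Matrix n n ℂ} (hK : ∀ m, IsOnsager (K m)) :
    IsOnsager fun ρ ξ => ∑ m, K m ρ ξ := by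
  refine fun ρ hρ => ⟨⟨fun ξ η => ?_, fun c ξ => ?_⟩, fun ξ hξ => ?_, fun ξ η => ?_, fun ξ => ?_⟩
  · simp only [(hK _ ρ hρ).1.map_add, Finset.sum_add_distrib]
  · simp only [(hK _ ρ hρ).1.map_smul, Finset.smul_sum]
  · simp only [Matrix.IsHermitian, Matrix.conjTranspose_sum, ((hK _ ρ hρ).2.1 ξ hξ).eq]
  · simp only [hs_sum_left, hs_sum_right, (hK _ ρ hρ).2.2.1]
  · rw [hs_sum_right, Complex.re_sum]
    exact Finset.sum_nonneg fun m _ => (hK m ρ hρ).2.2.2 ξ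

theorem sandwich_mlog_add {H ρ Q : Matrix n n ℂ} {ω : ℝ} (β : ℝ) (hρ : ρ.PosDef)
    (hQ : IsEigenpair H ω Q) : sandwich (-(β * ω)) Q ρ (mlog ρ + β • H) =
      ⁅Qᴴ, Real.exp (β * ω / 2) • (Q * ρ) - Real.exp (-(β * ω / 2)) • (ρ * Q)⁆ := by
  have h : ⁅Q, mlog ρ + β • H⁆ = ⁅Q, mlog ρ⁆ - (-(β * ω)) • Q := by
    rw [bracket_add, bracket_smul, hQ, smul_smul, neg_smul, sub_neg_eq_add]
  rw [sandwich, h, tiltedKuboMori_lie_mlog hρ, neg_neg, neg_div]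

theorem neg_blockOnsager_mlog_add {H ρ Q : Matrix n n ℂ} {ω : ℝ} (β : ℝ) (hH : H.IsHermitian)
    (hρ : ρ.PosDef) (hQ : IsEigenpair H ω Q) :
    -blockOnsager β ω Q ρ (mlog ρ + β • H) = blockLindblad β ω Q ρ := by
  have hconj := sandwich_mlog_add β hρ (hQ.conjTranspose hH)
  rw [mul_neg, neg_neg, neg_div, neg_neg, Matrix.conjTranspose_conjTranspose] at hconj
  rw [blockOnsager_eq_sandwich_add, sandwich_mlog_add β hρ hQ, hconj, blockLindblad]
  simp only [Ring.lie_def, Matrix.mul_sub, Matrix.sub_mul, Matrix.mul_smul, Matrix.smul_mul,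
    smul_add, smul_sub, Matrix.mul_assoc]
  abel

theorem isEntropicGradient_sum_blockOnsager {ι : Type*} [Fintype ι] {H : Matrix n n ℂ}
    (hH : H.IsHermitian) (β : ℝ) {L : Matrix n n ℂ →ₗ[ℂ] Matrix n n ℂ} {ω : ι → ℝ}
    {Q : ι → Matrix n n ℂ} (hQ : ∀ m, IsEigenpair H (ω m) (Q m))
    (hL : ∀ A, L A = ∑ m, blockLindblad β (ω m) (Q m) A) :
    IsEntropicGradient β H L (fun ρ ξ => ∑ m, blockOnsager β (ω m) (Q m) ρ ξ) := by
  refine isEntropicGradient_of_isOnsager hH β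
    (isOnsager_sum fun m => isOnsager_blockOnsager β (ω m) (Q m)) (fun ρ hρ => ?_) fun ρ hρ => ?_
  · simp only [blockOnsager_eq_sandwich_add, sandwich_one hρ.1, add_zero, Finset.sum_const_zero]
  · rw [hL, ← Finset.sum_neg_distrib]
    exact Finset.sum_congr rfl fun m _ => (neg_blockOnsager_mlog_add β hH hρ (hQ m)).symm

end BlockOnsager

section Covariance

variable {n m : Type*} [Fintype n] [DecidableEq n] [Fintype m] [DecidableEq m]
  (V : Matrix.unitaryGroup n ℂ) (U : Matrix.unitaryGroup m ℂ)

theorem unitaryConj_unitaryDiag (W : Matrix.unitaryGroup n ℂ) (r : n → ℝ) :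
    unitaryConj V (unitaryDiag W r) = unitaryDiag (V * W) r := by
  rw [unitaryDiag_apply, unitaryDiag_apply, unitaryConj_mul]

theorem tiltedKuboMori_unitaryConj {ρ : Matrix n n ℂ} (hρ : ρ.PosSemidef) (α : ℝ)
    (A : Matrix n n ℂ) :
    tiltedKuboMori α (unitaryConj V ρ) (unitaryConj V A) =
      unitaryConj V (tiltedKuboMori α ρ A) := by
  obtain ⟨W, r, rfl⟩ := exists_eq_unitaryDiag hρ.isHermitian
  obtain ⟨A, rfl⟩ := unitaryConj_surjective W A
  have hr := (posSemidef_unitaryDiag_iff W).1 hρ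
  rw [unitaryConj_unitaryDiag, ← unitaryConj_mul, tiltedKuboMori_unitaryDiag _ _ hr,
    tiltedKuboMori_unitaryDiag _ _ hr, unitaryConj_mul]

theorem unitaryConj_kroneckerUnitary (A : Matrix n n ℂ) (B : Matrix m m ℂ) :
    unitaryConj (kroneckerUnitary V U) (A ⊗ₖ B) = unitaryConj V A ⊗ₖ unitaryConj U B := by
  simp only [unitaryConj_apply, kroneckerUnitary, Matrix.mul_kronecker_mul,
    Matrix.conjTranspose_kronecker]

omit [DecidableEq n] in
theorem eq_of_hs_eq {B C : Matrix n n ℂ} (h : ∀ A, hs A B = hs A C) : B = C := by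
  rw [← sub_eq_zero, ← Matrix.trace_conjTranspose_mul_self_eq_zero_iff, Matrix.mul_sub,
    Matrix.trace_sub]
  exact sub_eq_zero.2 (h (B - C))

theorem trSnd_unitaryConj (X : Matrix (n × m) (n × m) ℂ) :
    trSnd (unitaryConj (kroneckerUnitary V U) X) = unitaryConj V (trSnd X) := by
  refine eq_of_hs_eq fun ξ => ?_
  obtain ⟨ξ, rfl⟩ := unitaryConj_surjective V ξ
  rw [hs_unitaryConj, hs_trSnd, hs_trSnd, ← map_one (unitaryConj U),
    ← unitaryConj_kroneckerUnitary, hs_unitaryConj, map_one]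

theorem tensorLindblad_unitaryConj (Q : Matrix (n × m) (n × m) ℂ) (τ : Matrix m m ℂ)
    (A : Matrix n n ℂ) :
    tensorLindblad (unitaryConj (kroneckerUnitary V U) Q) (unitaryConj U τ) (unitaryConj V A) =
      unitaryConj V (tensorLindblad Q τ A) := by
  rw [tensorLindblad, tensorLindblad, ← unitaryConj_kroneckerUnitary, ← unitaryConj_lie,
    ← unitaryConj_lie, trSnd_unitaryConj, map_neg]

theorem tensorOnsager_unitaryConj (Q : Matrix (n × m) (n × m) ℂ) {τ : Matrix m m ℂ}
    (hτ : τ.PosSemidef) {ρ : Matrix n n ℂ} (hρ : ρ.PosSemidef) (ξ : Matrix n n ℂ) :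
    tensorOnsager (unitaryConj (kroneckerUnitary V U) Q) (unitaryConj U τ) (unitaryConj V ρ)
      (unitaryConj V ξ) = unitaryConj V (tensorOnsager Q τ ρ ξ) := by
  rw [tensorOnsager, tensorOnsager, kuboMori_eq_tiltedKuboMori_zero,
    kuboMori_eq_tiltedKuboMori_zero, ← unitaryConj_kroneckerUnitary, ← map_one (unitaryConj U),
    ← unitaryConj_kroneckerUnitary, map_one, ← unitaryConj_lie,
    tiltedKuboMori_unitaryConj _ (hρ.kronecker hτ), ← unitaryConj_lie, trSnd_unitaryConj]

end Covariance

section Blocks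

variable {n m : Type*} [Fintype n] [Fintype m]

/-- The block `X k l` of `X = ∑ k l, X k l ⊗ e k (e l)*`. -/
def sndBlock {n m : Type*} (X : Matrix (n × m) (n × m) ℂ) (k l : m) : Matrix n n ℂ :=
  Matrix.of fun i j => X (i, k) (j, l)

theorem sndBlock_mul (X Y : Matrix (n × m) (n × m) ℂ) (k l : m) :
    sndBlock (X * Y) k l = ∑ p, sndBlock X k p * sndBlock Y p l := by
  ext i j
  simp only [sndBlock, Matrix.of_apply, Matrix.mul_apply, Matrix.sum_apply,
    Fintype.sum_prod_type]
  exact Finset.sum_comm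

theorem trSnd_lie (X Y : Matrix (n × m) (n × m) ℂ) :
    trSnd ⁅X, Y⁆ = ∑ k, ∑ l, ⁅sndBlock X k l, sndBlock Y l k⁆ := by
  have htr (X Y : Matrix (n × m) (n × m) ℂ) :
      trSnd (X * Y) = ∑ k, ∑ l, sndBlock X k l * sndBlock Y l k := by
    simp only [← sndBlock_mul]
    ext i j
    simp only [trSnd, sndBlock, Matrix.of_apply, Matrix.sum_apply]
  rw [Ring.lie_def, sub_eq_add_neg, trSnd_add, ← neg_one_smul ℂ (Y * X), trSnd_smul, htr, htr,
    Finset.sum_comm (f := fun k l => sndBlock Y k l * sndBlock X l k), neg_one_smul]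
  simp only [Ring.lie_def, sub_eq_add_neg, Finset.sum_neg_distrib,
    Finset.sum_add_distrib]

variable [DecidableEq m]

theorem sndBlock_kronecker_diagonal_mul_mul (A B : Matrix n n ℂ) (a b : m → ℂ)
    (X : Matrix (n × m) (n × m) ℂ) (k l : m) :
    sndBlock ((A ⊗ₖ Matrix.diagonal a) * X * (B ⊗ₖ Matrix.diagonal b)) k l =
      (a k * b l) • (A * sndBlock X k l * B) := by
  have hblock (C : Matrix n n ℂ) (c : m → ℂ) (p q : m) :
      sndBlock (C ⊗ₖ Matrix.diagonal c) p q = if p = q then c p • C else 0 := by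
    ext i j
    by_cases hpq : p = q <;> simp [sndBlock, hpq, mul_comm]
  simp only [sndBlock_mul, hblock, ite_mul, mul_ite, zero_mul, mul_zero, Finset.sum_ite_eq,
    Finset.sum_ite_eq', Finset.mem_univ, if_true, Matrix.smul_mul, Matrix.mul_smul, smul_smul]
  rw [mul_comm]

theorem sndBlock_lie_kronecker_diagonal (Q : Matrix (n × m) (n × m) ℂ) (A : Matrix n n ℂ)
    (s : m → ℂ) (k l : m) : sndBlock ⁅Q, A ⊗ₖ Matrix.diagonal s⁆ k l =
      s l • (sndBlock Q k l * A) - s k • (A * sndBlock Q k l) := by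
  classical
  have hright := sndBlock_kronecker_diagonal_mul_mul 1 A (fun _ => 1) s Q k l
  have hleft := sndBlock_kronecker_diagonal_mul_mul A 1 s (fun _ => 1) Q k l
  rw [Matrix.diagonal_one, Matrix.one_kronecker_one] at hright hleft
  rw [Matrix.one_mul, Matrix.one_mul, one_mul] at hright
  rw [Matrix.mul_one, Matrix.mul_one, mul_one] at hleft
  rw [Ring.lie_def, ← hright, ← hleft]
  rfl

theorem tensorLindblad_unitaryDiag_one (Q : Matrix (n × m) (n × m) ℂ) (s : m → ℝ)
    (A : Matrix n n ℂ) :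
    tensorLindblad Q (unitaryDiag 1 s) A = -∑ k, ∑ l, ⁅sndBlock Q k l,
      s k • (sndBlock Q l k * A) - s l • (A * sndBlock Q l k)⁆ := by
  rw [tensorLindblad, trSnd_lie, unitaryDiag_apply, unitaryConj_one]
  simp only [sndBlock_lie_kronecker_diagonal, Complex.coe_smul]

variable [DecidableEq n]

theorem mpow_kronecker {ρ : Matrix n n ℂ} {τ : Matrix m m ℂ} (hρ : ρ.PosSemidef)
    (hτ : τ.PosSemidef) (t : ℝ) : mpow (ρ ⊗ₖ τ) t = mpow ρ t ⊗ₖ mpow τ t := by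
  obtain ⟨U, r, rfl⟩ := exists_eq_unitaryDiag hρ.isHermitian
  obtain ⟨V, s, rfl⟩ := exists_eq_unitaryDiag hτ.isHermitian
  have hr := (posSemidef_unitaryDiag_iff U).1 hρ
  have hs := (posSemidef_unitaryDiag_iff V).1 hτ
  rw [unitaryDiag_kronecker, mpow_unitaryDiag, mpow_unitaryDiag, mpow_unitaryDiag,
    unitaryDiag_kronecker]
  congr 1
  ext x
  exact Real.mul_rpow (hr _) (hs _)

theorem rpow_mul_rpow_one_sub {a b : ℝ} (ha : 0 < a) (hb : 0 < b) (t : ℝ) :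
    a ^ t * b ^ (1 - t) = √(a * b) * (Real.exp (-(Real.log a - Real.log b) / 2) *
      Real.exp (t * (Real.log a - Real.log b))) := by
  rw [Real.rpow_def_of_pos ha, Real.rpow_def_of_pos hb, Real.sqrt_eq_rpow,
    Real.rpow_def_of_pos (mul_pos ha hb), Real.log_mul ha.ne' hb.ne', ← Real.exp_add,
    ← Real.exp_add, ← Real.exp_add]
  congr 1
  ring

-- The eigenvalues of the second factor enter only as the scalars `s k ^ t * s l ^ (1 - t)`, which
-- tilt the Kubo-Mori operator of the first factor.
theorem sndBlock_kuboMori {ρ : Matrix n n ℂ} (hρ : ρ.PosSemidef) {s : m → ℝ} (hs : ∀ k, 0 < s k)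
    (X : Matrix (n × m) (n × m) ℂ) (k l : m) :
    sndBlock (kuboMori (ρ ⊗ₖ unitaryDiag 1 s) X) k l =
      √(s k * s l) • tiltedKuboMori (Real.log (s k) - Real.log (s l)) ρ (sndBlock X k l) := by
  have hτ : (unitaryDiag 1 s).PosSemidef :=
    (posSemidef_unitaryDiag_iff 1).2 fun k => (hs k).le
  have hpow (t : ℝ) : mpow (ρ ⊗ₖ unitaryDiag 1 s) t =
      mpow ρ t ⊗ₖ Matrix.diagonal fun k => ((s k ^ t : ℝ) : ℂ) := by
    rw [mpow_kronecker hρ hτ, mpow_unitaryDiag, unitaryDiag_apply, unitaryConj_one]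
  have hblock (t : ℝ) (i j : n) : (mpow (ρ ⊗ₖ unitaryDiag 1 s) t * X *
      mpow (ρ ⊗ₖ unitaryDiag 1 s) (1 - t)) (i, k) (j, l) =
      √(s k * s l) • Real.exp (-(Real.log (s k) - Real.log (s l)) / 2) •
        (Real.exp (t * (Real.log (s k) - Real.log (s l))) •
          (mpow ρ t * sndBlock X k l * mpow ρ (1 - t))) i j := by
    have h := congrFun (congrFun (sndBlock_kronecker_diagonal_mul_mul (mpow ρ t) (mpow ρ (1 - t))
      (fun k => ((s k ^ t : ℝ) : ℂ)) (fun k => ((s k ^ (1 - t) : ℝ) : ℂ)) X k l) i) j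
    rw [← hpow, ← hpow, ← Complex.ofReal_mul, Complex.coe_smul,
      rpow_mul_rpow_one_sub (hs k) (hs l), mul_smul, mul_smul] at h
    exact h
  ext i j
  simp only [sndBlock, kuboMori, tiltedKuboMori, Matrix.of_apply, Matrix.smul_apply] at hblock ⊢
  simp only [hblock, intervalIntegral.integral_smul]

theorem tensorOnsager_unitaryDiag_one (Q : Matrix (n × m) (n × m) ℂ) {s : m → ℝ}
    (hs : ∀ k, 0 < s k) {ρ : Matrix n n ℂ} (hρ : ρ.PosSemidef) (ξ : Matrix n n ℂ) :
    tensorOnsager Q (unitaryDiag 1 s) ρ ξ = ∑ k, ∑ l, ⁅sndBlock Q k l,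
      √(s l * s k) • tiltedKuboMori (Real.log (s l) - Real.log (s k)) ρ ⁅sndBlock Q l k, ξ⁆⁆ := by
  have hblock (k l : m) : sndBlock ⁅Q, ξ ⊗ₖ (1 : Matrix m m ℂ)⁆ l k = ⁅sndBlock Q l k, ξ⁆ := by
    rw [← Matrix.diagonal_one, sndBlock_lie_kronecker_diagonal, one_smul, one_smul, Ring.lie_def]
  simp only [tensorOnsager, trSnd_lie, sndBlock_kuboMori hρ hs, hblock]

end Blocks

section Dual

variable {n m : Type*} [Fintype n] [DecidableEq n] [Fintype m] [DecidableEq m]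
  (U : Matrix.unitaryGroup m ℂ)

theorem transposeSndBasis_unitaryConj (Q : Matrix (n × m) (n × m) ℂ) :
    transposeSndBasis U (unitaryConj (kroneckerUnitary 1 U) Q) =
      unitaryConj (kroneckerUnitary 1 U) (transposeSnd Q) := by
  have hE : (kroneckerUnitary (1 : Matrix.unitaryGroup n ℂ) U : Matrix (n × m) (n × m) ℂ) =
      (1 : Matrix n n ℂ) ⊗ₖ (U : Matrix m m ℂ) := rfl
  have hQ := (unitaryConj (kroneckerUnitary (1 : Matrix.unitaryGroup n ℂ) U)).symm_apply_apply Q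
  rw [Unitary.conjStarAlgAut_symm_apply, Matrix.star_eq_conjTranspose, hE,
    Matrix.conjTranspose_kronecker, Matrix.conjTranspose_one] at hQ
  rw [transposeSndBasis, hQ, unitaryConj_apply, hE, Matrix.conjTranspose_kronecker,
    Matrix.conjTranspose_one]

theorem dualQ_unitaryConj (s : m → ℝ) (Q : Matrix (n × m) (n × m) ℂ) :
    dualQ (unitaryDiag U s) U (unitaryConj (kroneckerUnitary 1 U) Q) =
      unitaryConj (kroneckerUnitary 1 U)
        (((1 : Matrix n n ℂ) ⊗ₖ Matrix.diagonal fun k => (√(s k) : ℂ)) * transposeSnd Q *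
          ((1 : Matrix n n ℂ) ⊗ₖ Matrix.diagonal fun k => (√(s k) : ℂ))) := by
  rw [dualQ, transposeSndBasis_unitaryConj, mpow_unitaryDiag, unitaryDiag_apply, map_mul, map_mul,
    unitaryConj_kroneckerUnitary, map_one]
  simp only [Real.sqrt_eq_rpow]

theorem sndBlock_dual (s : m → ℝ) (Q : Matrix (n × m) (n × m) ℂ) (k l : m) :
    sndBlock (((1 : Matrix n n ℂ) ⊗ₖ Matrix.diagonal fun k => (√(s k) : ℂ)) * transposeSnd Q *
      ((1 : Matrix n n ℂ) ⊗ₖ Matrix.diagonal fun k => (√(s k) : ℂ))) k l =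
      (√(s k) * √(s l)) • sndBlock Q l k := by
  rw [sndBlock_kronecker_diagonal_mul_mul, Matrix.one_mul, Matrix.mul_one, ← Complex.ofReal_mul,
    Complex.coe_smul]
  rfl

theorem exists_pos_mul_self {x : ℝ} (hx : 0 < x) : ∃ a, 0 < a ∧ x = a * a :=
  ⟨√x, Real.sqrt_pos.2 hx, (Real.mul_self_sqrt hx.le).symm⟩

theorem tensorLindblad_dualQ {s : m → ℝ} (hs : ∀ k, 0 < s k) (Q : Matrix (n × m) (n × m) ℂ)
    (A : Matrix n n ℂ) :
    tensorLindblad (dualQ (unitaryDiag U s) U Q) (unitaryDiag U s)⁻¹ A =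
      tensorLindblad Q (unitaryDiag U s) A := by
  have hconj (r : m → ℝ) (X : Matrix (n × m) (n × m) ℂ) :
      tensorLindblad (unitaryConj (kroneckerUnitary 1 U) X) (unitaryDiag U r) A =
        tensorLindblad X (unitaryDiag 1 r) A := by
    have h := tensorLindblad_unitaryConj 1 U X (unitaryDiag 1 r) A
    rwa [unitaryConj_unitaryDiag, mul_one, unitaryConj_one, unitaryConj_one] at h
  obtain ⟨Q, rfl⟩ := unitaryConj_surjective (kroneckerUnitary 1 U) Q
  rw [dualQ_unitaryConj, inv_unitaryDiag U fun k => (hs k).ne', hconj, hconj,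
    tensorLindblad_unitaryDiag_one, tensorLindblad_unitaryDiag_one, Finset.sum_comm]
  congr 1
  refine Finset.sum_congr rfl fun k _ => Finset.sum_congr rfl fun l _ => ?_
  obtain ⟨a, ha, hak⟩ := exists_pos_mul_self (hs k)
  obtain ⟨b, hb, hbl⟩ := exists_pos_mul_self (hs l)
  simp only [sndBlock_dual, Pi.inv_apply, hak, hbl, Real.sqrt_mul_self ha.le,
    Real.sqrt_mul_self hb.le, smul_bracket, Matrix.smul_mul, Matrix.mul_smul, smul_smul]
  simp only [← bracket_smul, smul_sub, smul_smul]
  congr 3 <;> field_simp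

theorem tensorOnsager_dualQ {s : m → ℝ} (hs : ∀ k, 0 < s k) (Q : Matrix (n × m) (n × m) ℂ)
    {ρ : Matrix n n ℂ} (hρ : ρ.PosSemidef) (ξ : Matrix n n ℂ) :
    tensorOnsager (dualQ (unitaryDiag U s) U Q) (unitaryDiag U s)⁻¹ ρ ξ =
      tensorOnsager Q (unitaryDiag U s) ρ ξ := by
  have hconj {r : m → ℝ} (hr : ∀ k, 0 < r k) (X : Matrix (n × m) (n × m) ℂ) :
      tensorOnsager (unitaryConj (kroneckerUnitary 1 U) X) (unitaryDiag U r) ρ ξ =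
        tensorOnsager X (unitaryDiag 1 r) ρ ξ := by
    have h := tensorOnsager_unitaryConj 1 U X
      ((posSemidef_unitaryDiag_iff 1).2 fun k => (hr k).le) hρ ξ
    rwa [unitaryConj_unitaryDiag, mul_one, unitaryConj_one, unitaryConj_one,
      unitaryConj_one] at h
  obtain ⟨Q, rfl⟩ := unitaryConj_surjective (kroneckerUnitary 1 U) Q
  have hs' : ∀ k, 0 < s⁻¹ k := fun k => inv_pos.2 (hs k)
  rw [dualQ_unitaryConj, inv_unitaryDiag U fun k => (hs k).ne', hconj hs, hconj hs',
    tensorOnsager_unitaryDiag_one _ hs hρ, tensorOnsager_unitaryDiag_one _ hs' hρ,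
    Finset.sum_comm]
  refine Finset.sum_congr rfl fun k _ => Finset.sum_congr rfl fun l _ => ?_
  obtain ⟨a, ha, hak⟩ := exists_pos_mul_self (hs k)
  obtain ⟨b, hb, hbl⟩ := exists_pos_mul_self (hs l)
  have hsqrt : √((a * a)⁻¹ * (b * b)⁻¹) = a⁻¹ * b⁻¹ := by
    rw [mul_inv, mul_inv, mul_mul_mul_comm, Real.sqrt_mul_self (by positivity)]
  simp only [sndBlock_dual, Pi.inv_apply, hak, hbl, Real.sqrt_mul_self ha.le,
    Real.sqrt_mul_self hb.le, smul_bracket, bracket_smul, Real.log_inv, neg_sub_neg, hsqrt,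
    mul_mul_mul_comm b b a a]
  rw [Real.sqrt_mul_self (by positivity), ← Complex.coe_smul (a * b), tiltedKuboMori_smul hρ,
    Complex.coe_smul, bracket_smul, smul_smul, smul_smul]
  congr 1
  field_simp

end Dual

section Dissipator

variable {n : Type*} [Fintype n]

/-- The sesquilinear extension `A ↦ [V, A W*] + [V A, W*]` of the dissipator
`A ↦ [V, A V*] + [V A, V*]` of a jump operator `V`, from which Lindblad operators are built. -/
def dissipator (V W A : Matrix n n ℂ) : Matrix n n ℂ :=
  ⁅V, A * Wᴴ⁆ + ⁅V * A, Wᴴ⁆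

theorem dissipator_eq (V W A : Matrix n n ℂ) :
    dissipator V W A = (2 : ℂ) • (V * A * Wᴴ) - Wᴴ * V * A - A * (Wᴴ * V) := by
  simp only [dissipator, Ring.lie_def, two_smul, Matrix.mul_assoc]
  abel

theorem dissipator_smul_smul (c d : ℂ) (V W A : Matrix n n ℂ) :
    dissipator (c • V) (d • W) A = (c * star d) • dissipator V W A := by
  simp only [dissipator, Matrix.conjTranspose_smul, Matrix.mul_smul, Matrix.smul_mul, smul_bracket,
    bracket_smul, smul_smul, smul_add, mul_comm (star d)]

theorem dissipator_sum_sum {ι κ : Type*} (s : Finset ι) (t : Finset κ) (V : ι → Matrix n n ℂ)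
    (W : κ → Matrix n n ℂ) (A : Matrix n n ℂ) :
    dissipator (∑ i ∈ s, V i) (∑ j ∈ t, W j) A = ∑ i ∈ s, ∑ j ∈ t, dissipator (V i) (W j) A := by
  simp only [dissipator_eq, Matrix.conjTranspose_sum, Matrix.sum_mul, Matrix.mul_sum,
    Finset.smul_sum, Finset.sum_sub_distrib]
  rw [Finset.sum_comm (s := s) (f := fun i j => (W j)ᴴ * V i * A),
    Finset.sum_comm (s := s) (f := fun i j => A * ((W j)ᴴ * V i)),
    Finset.sum_comm (s := s) (f := fun i j => (2 : ℂ) • (V i * A * (W j)ᴴ))]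

theorem dissipator_sum {ι : Type*} (s : Finset ι) (V W : Matrix n n ℂ)
    (A : ι → Matrix n n ℂ) :
    dissipator V W (∑ i ∈ s, A i) = ∑ i ∈ s, dissipator V W (A i) := by
  simp only [dissipator_eq, Matrix.sum_mul, Matrix.mul_sum, Finset.smul_sum,
    Finset.sum_sub_distrib]

theorem dissipator_conjTranspose (V W A : Matrix n n ℂ) :
    (dissipator V W A)ᴴ = dissipator W V Aᴴ := by
  simp only [dissipator_eq, Matrix.conjTranspose_sub, Matrix.conjTranspose_smul,
    Matrix.conjTranspose_mul, Matrix.conjTranspose_conjTranspose, Matrix.mul_assoc, star_ofNat]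
  abel

theorem trace_dissipator (V W A : Matrix n n ℂ) : (dissipator V W A).trace = 0 := by
  simp only [dissipator, Ring.lie_def, Matrix.trace_add, Matrix.trace_sub, Matrix.trace_mul_comm V,
    Matrix.trace_mul_comm (V * A), sub_self, add_zero]

theorem hs_dissipator (V A B : Matrix n n ℂ) : hs B (dissipator V V A) =
    hs ((2 : ℂ) • (Vᴴ * B * V) - Vᴴ * V * B - B * (Vᴴ * V)) A := by
  have hjump : (Bᴴ * (V * A * Vᴴ)).trace = (Vᴴ * Bᴴ * V * A).trace := by
    rw [← Matrix.mul_assoc, Matrix.trace_mul_comm]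
    simp only [Matrix.mul_assoc]
  have hright : (Bᴴ * (A * (Vᴴ * V))).trace = (Vᴴ * V * Bᴴ * A).trace := by
    rw [← Matrix.mul_assoc, Matrix.trace_mul_comm]
    simp only [Matrix.mul_assoc]
  simp only [hs, dissipator_eq, Matrix.mul_sub, Matrix.mul_smul, Matrix.conjTranspose_sub,
    Matrix.conjTranspose_smul, Matrix.conjTranspose_mul, Matrix.conjTranspose_conjTranspose,
    Matrix.sub_mul, Matrix.smul_mul, Matrix.trace_sub, Matrix.trace_smul, hjump, hright]
  simp only [Matrix.mul_assoc, star_ofNat]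

theorem blockLindblad_eq (β ω : ℝ) (Q A : Matrix n n ℂ) :
    blockLindblad β ω Q A = (Real.exp (β * ω / 2) : ℂ) • dissipator Q Q A +
      (Real.exp (-(β * ω / 2)) : ℂ) • dissipator Qᴴ Qᴴ A := by
  simp only [blockLindblad, dissipator, Complex.coe_smul, Matrix.conjTranspose_conjTranspose]

open scoped MatrixOrder in
theorem IsLindblad.exists_dissipator {L : Matrix n n ℂ →ₗ[ℂ] Matrix n n ℂ} (hL : IsLindblad L) :
    ∃ (k : ℕ) (W : Fin k → Matrix n n ℂ), ∀ A, L A = ∑ r, dissipator (W r) (W r) A := by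
  obtain ⟨k, V, a, ha, hL⟩ := hL
  obtain ⟨B, rfl⟩ := CStarAlgebra.nonneg_iff_eq_star_mul_self.1 ha.nonneg
  refine ⟨k, fun r => ∑ p, star (B r p) • V p, fun A => ?_⟩
  simp only [dissipator_sum_sum, dissipator_smul_smul, star_star]
  rw [Finset.sum_comm, hL]
  refine Finset.sum_congr rfl fun p _ => ?_
  rw [Finset.sum_comm]
  refine Finset.sum_congr rfl fun q _ => ?_
  rw [← Finset.sum_smul]
  rfl

theorem IsLindblad.map_conjTranspose (hL : IsLindblad L) (A : Matrix n n ℂ) :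
    L Aᴴ = (L A)ᴴ := by
  obtain ⟨k, W, hW⟩ := hL.exists_dissipator
  simp only [hW, Matrix.conjTranspose_sum, dissipator_conjTranspose]

end Dissipator

section Frequency

variable {n : Type*} [Fintype n] {H Q R : Matrix n n ℂ} {ω ν : ℝ}

theorem IsEigenpair.sum {ι : Type*} {s : Finset ι} {V : ι → Matrix n n ℂ}
    (hV : ∀ i ∈ s, IsEigenpair H ω (V i)) : IsEigenpair H ω (∑ i ∈ s, V i) := by
  simp only [IsEigenpair, Ring.lie_def, Finset.sum_mul, Finset.mul_sum, ← Finset.sum_sub_distrib,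
    Finset.smul_sum]
  exact Finset.sum_congr rfl hV

theorem IsEigenpair.sub (hQ : IsEigenpair H ω Q) (hR : IsEigenpair H ω R) :
    IsEigenpair H ω (Q - R) := by
  rw [IsEigenpair, ← neg_bracket, bracket_sub, neg_sub, ← neg_bracket, hR, ← neg_bracket, hQ,
    smul_sub, neg_sub_neg]

theorem IsEigenpair.dissipator {V W A : Matrix n n ℂ} {ω ω' ν : ℝ} (hH : H.IsHermitian)
    (hV : IsEigenpair H ω V) (hW : IsEigenpair H ω' W) (hA : IsEigenpair H ν A) :
    IsEigenpair H (ω + ν - ω') (dissipator V W A) := by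
  have hW' := hW.conjTranspose hH
  have hjump : IsEigenpair H (ω + ν - ω') (V * A * Wᴴ) := (hV.mul hA).mul hW'
  have hleft := (hW'.mul hV).mul hA
  have hright := hA.mul (hW'.mul hV)
  rw [show -ω' + ω + ν = ω + ν - ω' by ring] at hleft
  rw [show ν + (-ω' + ω) = ω + ν - ω' by ring] at hright
  rw [dissipator_eq]
  exact ((hjump.smul 2).sub hleft).sub hright

theorem IsEigenpair.hs_eq_zero (hH : H.IsHermitian) (hQ : IsEigenpair H ω Q)
    (hR : IsEigenpair H ν R) (hων : ω ≠ ν) : hs Q R = 0 := by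
  have h := hs_conjTranspose_lie H Q R
  rw [hH.eq, ← neg_bracket R, hR, ← neg_bracket Q, hQ, ← neg_smul, ← neg_smul] at h
  simp only [hs, Matrix.conjTranspose_smul, Matrix.smul_mul, Matrix.mul_smul, Matrix.trace_smul,
    star_trivial, ← sub_eq_zero (b := -ω • _), ← sub_smul] at h
  exact (smul_eq_zero.1 h).resolve_left fun h0 => hων (by linarith)

theorem IsEigenpair.eq_sum_ite (hH : H.IsHermitian) (hQ : IsEigenpair H ν Q) {ι : Type*}
    {s : Finset ι} {f : ι → ℝ} {V : ι → Matrix n n ℂ} (hV : ∀ i ∈ s, IsEigenpair H (f i) (V i))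
    (hsum : Q = ∑ i ∈ s, V i) : Q = ∑ i ∈ s, if f i = ν then V i else 0 := by
  rw [← Finset.sum_filter, ← sub_eq_zero, ← Matrix.trace_conjTranspose_mul_self_eq_zero_iff]
  set D := Q - ∑ i ∈ s with f i = ν, V i with hD
  have hDV : D = ∑ i ∈ s with f i ≠ ν, V i := by
    rw [hD, sub_eq_iff_eq_add', Finset.sum_filter_add_sum_filter_not, hsum]
  have hDν : IsEigenpair H ν D := hQ.sub <| .sum fun i hi => by
    obtain ⟨his, hiν⟩ := Finset.mem_filter.1 hi
    exact hiν ▸ hV i his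
  calc hs D D = hs D (∑ i ∈ s with f i ≠ ν, V i) := by rw [← hDV]
    _ = 0 := by
      rw [hs_sum_right]
      refine Finset.sum_eq_zero fun i hi => ?_
      obtain ⟨his, hiν⟩ := Finset.mem_filter.1 hi
      exact hDν.hs_eq_zero hH (hV i his) (Ne.symm hiν)

variable [DecidableEq n]

theorem isEigenpair_unitaryDiag_iff {U : Matrix.unitaryGroup n ℂ} {h : n → ℝ} :
    IsEigenpair (unitaryDiag U h) ω (unitaryConj U Q) ↔ ∀ i j, Q i j ≠ 0 → h j - h i = ω := by
  rw [IsEigenpair, unitaryDiag_apply, ← unitaryConj_lie, ← Complex.coe_smul, ← map_smul,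
    EmbeddingLike.apply_eq_iff_eq, ← Matrix.ext_iff]
  refine forall₂_congr fun i j => ?_
  rw [Ring.lie_def, Matrix.sub_apply, Matrix.mul_diagonal, Matrix.diagonal_mul, Matrix.smul_apply,
    smul_eq_mul, mul_comm, ← sub_mul, mul_eq_mul_right_iff, ← Complex.ofReal_sub,
    Complex.ofReal_inj, or_comm, or_iff_not_imp_left]

theorem unitaryConj_mul_unitaryDiag_eq_smul_iff {U : Matrix.unitaryGroup n ℂ} {g : n → ℝ}
    {c : ℝ} : unitaryConj U Q * unitaryDiag U g = (c : ℂ) • (unitaryDiag U g * unitaryConj U Q) ↔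
      ∀ i j, Q i j ≠ 0 → g j = c * g i := by
  rw [unitaryDiag_apply, ← map_mul, ← map_mul, ← map_smul, EmbeddingLike.apply_eq_iff_eq,
    ← Matrix.ext_iff]
  refine forall₂_congr fun i j => ?_
  rw [Matrix.mul_diagonal, Matrix.smul_apply, Matrix.diagonal_mul, smul_eq_mul, ← mul_assoc,
    mul_comm, mul_eq_mul_right_iff, ← Complex.ofReal_mul, Complex.ofReal_inj, or_comm,
    or_iff_not_imp_left]

omit [DecidableEq n] in
theorem gibbsWeight_eq_exp_mul_iff {β : ℝ} (hβ : β ≠ 0) {h : n → ℝ} {i j : n} :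
    gibbsWeight β h j = Real.exp (-(β * ω)) * gibbsWeight β h i ↔ h j - h i = ω := by
  have : Nonempty n := ⟨i⟩
  rw [gibbsWeight, gibbsWeight, mul_left_comm, mul_right_inj' (inv_pos.2 (partition_pos β h)).ne',
    ← Real.exp_add, Real.exp_eq_exp, ← mul_right_inj' hβ (b := h j - h i)]
  constructor <;> intro hij <;> linear_combination -hij

theorem isEigenpair_iff_mul_gibbs (hH : H.IsHermitian) {β : ℝ} (hβ : β ≠ 0) :
    IsEigenpair H ω Q ↔ Q * gibbs β H = (Real.exp (-(β * ω)) : ℂ) • (gibbs β H * Q) := by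
  obtain ⟨U, h, rfl⟩ := exists_eq_unitaryDiag hH
  obtain ⟨Q, rfl⟩ := unitaryConj_surjective U Q
  simp only [isEigenpair_unitaryDiag_iff, gibbs_unitaryDiag,
    unitaryConj_mul_unitaryDiag_eq_smul_iff, gibbsWeight_eq_exp_mul_iff hβ]

/-- The component with frequency `ω` of an operator that is expressed in an eigenbasis of the
Hamiltonian with eigenvalues `h`. -/
def freqPart (h : n → ℝ) (ω : ℝ) (X : Matrix n n ℂ) : Matrix n n ℂ :=
  Matrix.of fun i j => if h j - h i = ω then X i j else 0

omit [DecidableEq n] in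
theorem exists_sum_isEigenpair_eq (hH : H.IsHermitian) : ∃ s : Finset ℝ, ∀ X : Matrix n n ℂ,
    ∃ V : ℝ → Matrix n n ℂ, (∀ ω, IsEigenpair H ω (V ω)) ∧ ∑ ω ∈ s, V ω = X := by
  classical
  obtain ⟨U, h, rfl⟩ := exists_eq_unitaryDiag hH
  refine ⟨Finset.univ.image fun x : n × n => h x.2 - h x.1, fun X => ?_⟩
  obtain ⟨X, rfl⟩ := unitaryConj_surjective U X
  refine ⟨fun ω => unitaryConj U (freqPart h ω X), fun ω => ?_, ?_⟩
  · refine isEigenpair_unitaryDiag_iff.2 fun i j hij => ?_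
    by_contra hne
    exact hij (if_neg hne)
  · rw [← map_sum]
    congr 1
    ext i j
    simp only [Matrix.sum_apply, freqPart, Matrix.of_apply, Finset.sum_ite_eq]
    exact if_pos (Finset.mem_image_of_mem (fun x : n × n => h x.2 - h x.1)
      (Finset.mem_univ (i, j)))

end Frequency

section DetailedBalance

variable {n : Type*} [Fintype n] [DecidableEq n] {L : Matrix n n ℂ →ₗ[ℂ] Matrix n n ℂ}

theorem hsAdjoint_conjTranspose (hL : ∀ A, L Aᴴ = (L A)ᴴ) (B : Matrix n n ℂ) :
    hsAdjoint L Bᴴ = (hsAdjoint L B)ᴴ := by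
  have hs_conjTranspose (A B : Matrix n n ℂ) : hs A Bᴴ = hs B Aᴴ := by
    rw [hs, hs, ← Matrix.conjTranspose_mul, ← Matrix.conjTranspose_mul,
      Matrix.trace_conjTranspose, Matrix.trace_conjTranspose, Matrix.trace_mul_comm]
  refine eq_of_hs_eq fun A => ?_
  rw [hs_conjTranspose, hs_hsAdjoint, hL, hs_conjTranspose, ← star_hs, hs_hsAdjoint, star_hs]

theorem hsAdjoint_eq_sum {ι : Type*} [Fintype ι] {Q : ι → Matrix n n ℂ}
    (hQ : ∀ A, L A = ∑ i, dissipator (Q i) (Q i) A) (B : Matrix n n ℂ) :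
    hsAdjoint L B = ∑ i, ((2 : ℂ) • ((Q i)ᴴ * B * Q i) - (Q i)ᴴ * Q i * B
      - B * ((Q i)ᴴ * Q i)) := by
  refine eq_of_hs_eq fun A => ?_
  rw [← star_hs, ← star_hs _ A, hs_hsAdjoint, hQ, hs_sum_right, hs_sum_left]
  simp only [hs_dissipator]

variable {σ : Matrix n n ℂ}

theorem DetailedBalance.map_mul (h : DetailedBalance L σ) (B : Matrix n n ℂ) :
    L (B * σ) = hsAdjoint L B * σ :=
  eq_of_hs_eq fun A => by rw [← h.2, hs_hsAdjoint]

theorem DetailedBalance.mul_map_mul (h : DetailedBalance L σ) (hL : ∀ A, L Aᴴ = (L A)ᴴ)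
    (hσ : σ.IsHermitian) (B : Matrix n n ℂ) : σ * L (B * σ) = L (σ * B) * σ := by
  have hleft : L (σ * B) = σ * hsAdjoint L B := by
    have hB := congrArg Matrix.conjTranspose (h.map_mul Bᴴ)
    rwa [← hL, Matrix.conjTranspose_mul, Matrix.conjTranspose_mul, ← hsAdjoint_conjTranspose hL,
      Matrix.conjTranspose_conjTranspose, hσ.eq] at hB
  rw [h.map_mul, hleft, Matrix.mul_assoc]

variable {H : Matrix n n ℂ} {β ν : ℝ}

theorem exists_eq_mul_gibbs (hH : H.IsHermitian) (β : ℝ) (A : Matrix n n ℂ) :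
    ∃ B, A = B * gibbs β H := by
  have hdet := (Matrix.isUnit_iff_isUnit_det _).1 (posDef_gibbs hH β).isUnit
  exact ⟨A * (gibbs β H)⁻¹, (Matrix.nonsing_inv_mul_cancel_right _ A hdet).symm⟩

-- Since `L` commutes with the modular operator `A ↦ σ A σ⁻¹`, it preserves its eigenspaces.
theorem DetailedBalance.map_isEigenpair (h : DetailedBalance L (gibbs β H)) (hL : IsLindblad L)
    (hH : H.IsHermitian) (hβ : β ≠ 0) {A : Matrix n n ℂ} (hA : IsEigenpair H ν A) :
    IsEigenpair H ν (L A) := by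
  rw [isEigenpair_iff_mul_gibbs hH hβ] at hA ⊢
  obtain ⟨B, rfl⟩ := exists_eq_mul_gibbs hH β A
  have hunit := (posDef_gibbs hH β).isUnit
  have hB : B * gibbs β H = (Real.exp (-(β * ν)) : ℂ) • (gibbs β H * B) := by
    refine hunit.mul_right_cancel ?_
    rw [hA, Matrix.smul_mul, Matrix.mul_assoc]
  rw [h.mul_map_mul hL.map_conjTranspose (posDef_gibbs hH β).isHermitian, ← Matrix.smul_mul,
    ← map_smul, ← hB]

theorem DetailedBalance.exists_sum_dissipator_isEigenpair (h : DetailedBalance L (gibbs β H))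
    (hL : IsLindblad L) (hH : H.IsHermitian) (hβ : β ≠ 0) :
    ∃ (k : ℕ) (s : Finset ℝ) (V : Fin k → ℝ → Matrix n n ℂ), (∀ r ω, IsEigenpair H ω (V r ω)) ∧
      ∀ A, L A = ∑ r, ∑ ω ∈ s, dissipator (V r ω) (V r ω) A := by
  obtain ⟨k, W, hW⟩ := hL.exists_dissipator
  obtain ⟨s, hs⟩ := exists_sum_isEigenpair_eq hH
  choose V hV hVsum using fun r => hs (W r)
  have hdouble (A : Matrix n n ℂ) : L A = ∑ x ∈ Finset.univ ×ˢ s ×ˢ s,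
      dissipator (V x.1 x.2.1) (V x.1 x.2.2) A := by
    simp only [hW, Finset.sum_product, ← dissipator_sum_sum, hVsum]
  have hdiag (ν : ℝ) (X : Matrix n n ℂ) (hX : IsEigenpair H ν X) :
      L X = ∑ r, ∑ ω ∈ s, dissipator (V r ω) (V r ω) X := by
    rw [(h.map_isEigenpair hL hH hβ hX).eq_sum_ite hH
      (fun x _ => (hV x.1 x.2.1).dissipator hH (hV x.1 x.2.2) hX) (hdouble X)]
    simp only [Finset.sum_product, add_sub_right_comm, add_eq_right, sub_eq_zero,
      Finset.sum_ite_eq, Finset.sum_ite_mem, Finset.inter_self]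
  refine ⟨k, s, V, hV, fun A => ?_⟩
  obtain ⟨X, hX, rfl⟩ := hs A
  simp only [map_sum, dissipator_sum, hdiag _ _ (hX _)]
  rw [Finset.sum_comm]
  exact Finset.sum_congr rfl fun r _ => Finset.sum_comm

end DetailedBalance

section BlockExistence

variable {n : Type*} [Fintype n] [DecidableEq n] {H Q : Matrix n n ℂ} {β ω : ℝ}

theorem IsEigenpair.commute_gibbs (hH : H.IsHermitian) (hβ : β ≠ 0) (hQ : IsEigenpair H 0 Q) :
    Commute Q (gibbs β H) := by
  have h := (isEigenpair_iff_mul_gibbs hH hβ).1 hQ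
  rwa [mul_zero, neg_zero, Real.exp_zero, Complex.ofReal_one, one_smul] at h

theorem IsEigenpair.commute_conjTranspose_mul_gibbs (hH : H.IsHermitian) (hβ : β ≠ 0)
    (hQ : IsEigenpair H ω Q) : Commute (Qᴴ * Q) (gibbs β H) := by
  have hQQ := (hQ.conjTranspose hH).mul hQ
  rw [neg_add_cancel] at hQQ
  exact hQQ.commute_gibbs hH hβ

variable {L : Matrix n n ℂ →ₗ[ℂ] Matrix n n ℂ} {ι : Type*} [Fintype ι] {f : ι → ℝ}
  {V : ι → Matrix n n ℂ}

theorem DetailedBalance.eq_sum_of_isEigenpair (h : DetailedBalance L (gibbs β H))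
    (hH : H.IsHermitian) (hβ : β ≠ 0) (hV : ∀ i, IsEigenpair H (f i) (V i))
    (hL : ∀ A, L A = ∑ i, dissipator (V i) (V i) A) (A : Matrix n n ℂ) :
    L A = ∑ i, ((2 * Real.exp (-(β * f i)) : ℂ) • ((V i)ᴴ * A * V i) - (V i)ᴴ * V i * A
      - A * ((V i)ᴴ * V i)) := by
  obtain ⟨B, rfl⟩ := exists_eq_mul_gibbs hH β A
  rw [h.map_mul, hsAdjoint_eq_sum hL, Finset.sum_mul]
  refine Finset.sum_congr rfl fun i _ => ?_
  have hjump : (V i)ᴴ * B * V i * gibbs β H =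
      (Real.exp (-(β * f i)) : ℂ) • ((V i)ᴴ * (B * gibbs β H) * V i) := by
    rw [Matrix.mul_assoc, (isEigenpair_iff_mul_gibbs hH hβ).1 (hV i)]
    simp only [Matrix.mul_smul, Matrix.mul_assoc]
  rw [Matrix.sub_mul, Matrix.sub_mul, Matrix.smul_mul, hjump, smul_smul, Matrix.mul_assoc B,
    ((hV i).commute_conjTranspose_mul_gibbs hH hβ).eq, Matrix.mul_assoc _ B, Matrix.mul_assoc B]

-- The two sides agree because `L A` has trace zero for every `A`.
theorem DetailedBalance.sum_mul_conjTranspose (h : DetailedBalance L (gibbs β H))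
    (hH : H.IsHermitian) (hβ : β ≠ 0) (hV : ∀ i, IsEigenpair H (f i) (V i))
    (hL : ∀ A, L A = ∑ i, dissipator (V i) (V i) A) :
    ∑ i, (Real.exp (-(β * f i)) : ℂ) • (V i * (V i)ᴴ) = ∑ i, (V i)ᴴ * V i := by
  refine eq_of_hs_eq fun A => ?_
  have htrace : (L Aᴴ).trace = 0 := by
    simp only [hL, Matrix.trace_sum, trace_dissipator, Finset.sum_const_zero]
  have hcycle (i : ι) : ((V i)ᴴ * Aᴴ * V i).trace = (Aᴴ * (V i * (V i)ᴴ)).trace := by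
    rw [Matrix.mul_assoc, Matrix.trace_mul_comm, Matrix.mul_assoc]
  simp only [h.eq_sum_of_isEigenpair hH hβ hV hL, Matrix.trace_sum, Matrix.trace_sub,
    Matrix.trace_smul, hcycle, Matrix.trace_mul_comm _ Aᴴ, Finset.sum_sub_distrib, smul_eq_mul,
    mul_assoc (2 : ℂ), ← Finset.mul_sum _ _ (2 : ℂ)] at htrace
  simp only [hs, Finset.mul_sum, Matrix.mul_smul, Matrix.trace_sum, Matrix.trace_smul, smul_eq_mul]
  linear_combination (1 / 2 : ℂ) * htrace

theorem DetailedBalance.eq_sum_dissipator_conjTranspose (h : DetailedBalance L (gibbs β H))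
    (hH : H.IsHermitian) (hβ : β ≠ 0) (hV : ∀ i, IsEigenpair H (f i) (V i))
    (hL : ∀ A, L A = ∑ i, dissipator (V i) (V i) A) (A : Matrix n n ℂ) :
    L A = ∑ i, (Real.exp (-(β * f i)) : ℂ) • dissipator (V i)ᴴ (V i)ᴴ A := by
  simp only [h.eq_sum_of_isEigenpair hH hβ hV hL, Finset.sum_sub_distrib, ← Finset.sum_mul,
    ← Finset.mul_sum, ← h.sum_mul_conjTranspose hH hβ hV hL]
  simp only [dissipator_eq, Matrix.conjTranspose_conjTranspose, smul_sub, smul_smul,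
    Finset.sum_sub_distrib, Finset.sum_mul, Finset.mul_sum, Matrix.smul_mul, Matrix.mul_smul,
    mul_comm (2 : ℂ)]

omit [DecidableEq n] in
theorem blockLindblad_sqrt_smul (β ω : ℝ) (Q A : Matrix n n ℂ) :
    blockLindblad β ω ((√(Real.exp (-(β * ω / 2)) / 2) : ℂ) • Q) A =
      (2⁻¹ : ℂ) • (dissipator Q Q A + (Real.exp (-(β * ω)) : ℂ) • dissipator Qᴴ Qᴴ A) := by
  set c := √(Real.exp (-(β * ω / 2)) / 2)
  have hcc : c * c = Real.exp (-(β * ω / 2)) / 2 := Real.mul_self_sqrt (by positivity)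
  have hgain : Real.exp (β * ω / 2) * (c * c) = 2⁻¹ := by
    rw [hcc, ← mul_div_assoc, ← Real.exp_add, add_neg_cancel, Real.exp_zero, one_div]
  have hloss : Real.exp (-(β * ω / 2)) * (c * c) = 2⁻¹ * Real.exp (-(β * ω)) := by
    rw [hcc, ← mul_div_assoc, ← Real.exp_add, ← neg_add, add_halves, div_eq_inv_mul]
  rw [blockLindblad_eq, Matrix.conjTranspose_smul, dissipator_smul_smul, dissipator_smul_smul,
    star_star, smul_smul, smul_smul, Complex.star_def, Complex.conj_ofReal, ← Complex.ofReal_mul,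
    ← Complex.ofReal_mul, ← Complex.ofReal_mul, hgain, hloss, smul_add, smul_smul]
  push_cast
  rfl

theorem DetailedBalance.exists_sum_blockLindblad (h : DetailedBalance L (gibbs β H))
    (hL : IsLindblad L) (hH : H.IsHermitian) (hβ : β ≠ 0) :
    ∃ (M : ℕ) (ω : Fin M → ℝ) (Q : Fin M → Matrix n n ℂ), (∀ m, IsEigenpair H (ω m) (Q m)) ∧
      ∀ A, L A = ∑ m, blockLindblad β (ω m) (Q m) A := by
  obtain ⟨k, s, V, hV, hLV⟩ := h.exists_sum_dissipator_isEigenpair hL hH hβ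
  let e := (Fintype.equivFin (Fin k × s)).symm
  let ω m : ℝ := (e m).2
  let Q m := V (e m).1 (ω m)
  have hQ m : IsEigenpair H (ω m) (Q m) := hV _ _
  have hLQ A : L A = ∑ m, dissipator (Q m) (Q m) A := by
    rw [hLV, e.sum_comp fun x => dissipator (V x.1 x.2) (V x.1 x.2) A, Fintype.sum_prod_type]
    exact Finset.sum_congr rfl fun r _ => (Finset.sum_coe_sort s _).symm
  refine ⟨_, ω, fun m => (√(Real.exp (-(β * ω m / 2)) / 2) : ℂ) • Q m,
    fun m => (hQ m).smul _, fun A => ?_⟩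
  simp only [blockLindblad_sqrt_smul]
  rw [← Finset.smul_sum, Finset.sum_add_distrib, ← hLQ,
    ← h.eq_sum_dissipator_conjTranspose hH hβ hQ hLQ, ← two_smul ℂ, inv_smul_smul₀ two_ne_zero]

end BlockExistence

section GramMatrix

variable {n : Type*}

/-- The rank-one operator `|V⟩⟨W|` on `L(𝔥)`, as a matrix in the basis of matrix units. -/
def ketBra (V W : Matrix n n ℂ) : Matrix (n × n) (n × n) ℂ :=
  Matrix.of fun x y => V x.1 x.2 * star (W y.1 y.2)

theorem posSemidef_ketBra [Finite n] (V : Matrix n n ℂ) : (ketBra V V).PosSemidef :=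
  Matrix.posSemidef_vecMulVec_self_star fun x : n × n => V x.1 x.2

/-- The operator `∑ m, |Q m⟩⟨Q m| + |(Q m)*⟩⟨(Q m)*|` on `L(𝔥)`, whose square root is rearranged
into a tensor representation. -/
def blockGram {ι : Type*} [Fintype ι] (Q : ι → Matrix n n ℂ) : Matrix (n × n) (n × n) ℂ :=
  ∑ m, (ketBra (Q m) (Q m) + ketBra (Q m)ᴴ (Q m)ᴴ)

variable {ι : Type*} [Fintype ι]

theorem posSemidef_blockGram [Finite n] (Q : ι → Matrix n n ℂ) : (blockGram Q).PosSemidef :=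
  Matrix.posSemidef_sum _ fun _ _ => (posSemidef_ketBra _).add (posSemidef_ketBra _)

theorem blockGram_swap (Q : ι → Matrix n n ℂ) (x y : n × n) :
    blockGram Q y.swap x.swap = blockGram Q x y := by
  simp only [blockGram, Matrix.sum_apply, Matrix.add_apply, ketBra, Matrix.of_apply,
    Matrix.conjTranspose_apply, star_star, Prod.fst_swap, Prod.snd_swap]
  exact Finset.sum_congr rfl fun m _ => by ring

variable {h : n → ℝ}

theorem conjTranspose_frequency {Q : Matrix n n ℂ} {ω : ℝ}
    (hQ : ∀ i j, Q i j ≠ 0 → h j - h i = ω) (i j : n) (hij : Qᴴ i j ≠ 0) : h j - h i = -ω := by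
  rw [← hQ j i (star_ne_zero.1 hij), neg_sub]

theorem ketBra_frequency {Q : Matrix n n ℂ} {ω : ℝ} (hQ : ∀ i j, Q i j ≠ 0 → h j - h i = ω)
    {x y : n × n} (hxy : ketBra Q Q x y ≠ 0) : h x.2 - h x.1 = h y.2 - h y.1 := by
  obtain ⟨hx, hy⟩ := mul_ne_zero_iff.1 hxy
  rw [hQ _ _ hx, hQ _ _ (star_ne_zero.1 hy)]

theorem blockGram_frequency {ω : ι → ℝ} {Q : ι → Matrix n n ℂ}
    (hQ : ∀ m i j, Q m i j ≠ 0 → h j - h i = ω m) {x y : n × n}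
    (hxy : blockGram Q x y ≠ 0) : h x.2 - h x.1 = h y.2 - h y.1 := by
  rw [blockGram, Matrix.sum_apply] at hxy
  obtain ⟨m, -, hm⟩ := Finset.exists_ne_zero_of_sum_ne_zero hxy
  rw [Matrix.add_apply] at hm
  by_cases hleft : ketBra (Q m) (Q m) x y = 0
  · rw [hleft, zero_add] at hm
    exact ketBra_frequency (conjTranspose_frequency (hQ m)) hm
  · exact ketBra_frequency (hQ m) hleft

end GramMatrix

section SquareRoot

open scoped MatrixOrder

variable {m : Type*} [Fintype m] [DecidableEq m]

theorem sqrt_transpose_submatrix {C : Matrix m m ℂ} (hC : C.PosSemidef) (e : m ≃ m) :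
    CFC.sqrt (Cᵀ.submatrix e e) = (CFC.sqrt C)ᵀ.submatrix e e := by
  have hsqrt : (CFC.sqrt C).PosSemidef := Matrix.nonneg_iff_posSemidef.1 (CFC.sqrt_nonneg C)
  refine CFC.sqrt_unique ?_ (hsqrt.transpose.submatrix e).nonneg
  rw [Matrix.submatrix_mul_equiv, ← Matrix.transpose_mul, CFC.sqrt_mul_sqrt_self C hC.nonneg]

theorem eq_of_sqrt_apply_ne_zero {C : Matrix m m ℂ} {g : m → ℝ}
    (hC : ∀ x y, C x y ≠ 0 → g x = g y) {x y : m} (hxy : CFC.sqrt C x y ≠ 0) : g x = g y := by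
  have hcomm : Commute C (Matrix.diagonal fun x => (g x : ℂ)) := by
    change C * _ = _ * C
    ext x y
    rw [Matrix.mul_diagonal, Matrix.diagonal_mul, mul_comm, mul_eq_mul_right_iff,
      Complex.ofReal_inj, or_iff_not_imp_right]
    exact fun hxy => (hC x y hxy).symm
  have h := congrFun (congrFun (hcomm.cfcₙ_nnreal NNReal.sqrt).eq x) y
  rw [Matrix.mul_diagonal, Matrix.diagonal_mul, mul_comm] at h
  exact (Complex.ofReal_inj.1 (mul_right_cancel₀ hxy h)).symm

end SquareRoot

section Kossakowski

variable {n : Type*} [Fintype n] [DecidableEq n]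

/-- The Lindblad operator, evaluated at `A`, whose coefficient matrix with respect to the matrix
units (its Kossakowski matrix) is `C`. -/
def kossakowski (A : Matrix n n ℂ) : Matrix (n × n) (n × n) ℂ →ₗ[ℂ] Matrix n n ℂ :=
  ∑ x, ∑ y, (Matrix.entryLinearMap ℂ ℂ x y).smulRight
    (dissipator (Matrix.single x.1 x.2 1) (Matrix.single y.1 y.2 1) A)

theorem kossakowski_ketBra (V W A : Matrix n n ℂ) :
    kossakowski A (ketBra V W) = dissipator V W A := by
  have hsum (X : Matrix n n ℂ) : X = ∑ x : n × n, X x.1 x.2 • Matrix.single x.1 x.2 1 := by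
    conv_lhs => rw [Matrix.matrix_eq_sum_single X]
    simp only [Fintype.sum_prod_type, Matrix.smul_single, smul_eq_mul, mul_one]
  conv_rhs => rw [hsum V, hsum W]
  simp only [dissipator_sum_sum, dissipator_smul_smul, kossakowski, LinearMap.sum_apply,
    LinearMap.smulRight_apply, Matrix.entryLinearMap_apply, ketBra, Matrix.of_apply]

/-- The operator `A ↦ σ^(1/2) A σ^(-1/2)` on `L(𝔥)`, as a matrix in the basis of matrix units,
where `σ` is the equilibrium state of a diagonal Hamiltonian with eigenvalues `h`. -/
def modularSqrt (β : ℝ) (h : n → ℝ) : Matrix (n × n) (n × n) ℂ :=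
  Matrix.diagonal fun x => (Real.exp (β * (h x.2 - h x.1) / 2) : ℂ)

theorem modularSqrt_mul_ketBra {h : n → ℝ} {Q : Matrix n n ℂ} {ω : ℝ}
    (hQ : ∀ i j, Q i j ≠ 0 → h j - h i = ω) (β : ℝ) (R : Matrix n n ℂ) :
    modularSqrt β h * ketBra Q R = (Real.exp (β * ω / 2) : ℂ) • ketBra Q R := by
  ext x y
  rw [modularSqrt, Matrix.diagonal_mul, Matrix.smul_apply, smul_eq_mul]
  by_cases hx : Q x.1 x.2 = 0
  · simp only [ketBra, Matrix.of_apply, hx, zero_mul, mul_zero]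
  · rw [hQ _ _ hx]

theorem kossakowski_modularSqrt_mul_blockGram {ι : Type*} [Fintype ι] {h : n → ℝ} {ω : ι → ℝ}
    {Q : ι → Matrix n n ℂ} (hQ : ∀ m i j, Q m i j ≠ 0 → h j - h i = ω m) (β : ℝ)
    (A : Matrix n n ℂ) :
    kossakowski A (modularSqrt β h * blockGram Q) = ∑ m, blockLindblad β (ω m) (Q m) A := by
  simp only [blockGram, Matrix.mul_sum, Matrix.mul_add, modularSqrt_mul_ketBra (hQ _),
    modularSqrt_mul_ketBra (conjTranspose_frequency (hQ _)), map_sum, map_add, map_smul,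
    kossakowski_ketBra, blockLindblad_eq, mul_neg, neg_div]

end Kossakowski

section TensorExistence

variable {n m : Type*} [Fintype n] [DecidableEq n] [Fintype m] [DecidableEq m]

omit [Fintype n] [DecidableEq n] [Fintype m] [DecidableEq m] in
theorem conjTranspose_sndBlock {Q : Matrix (n × m) (n × m) ℂ} (hQ : Q.IsHermitian) (k l : m) :
    (sndBlock Q k l)ᴴ = sndBlock Q l k := by
  ext i j
  exact hQ.apply _ _

omit [DecidableEq n] in
theorem tensorLindblad_unitaryDiag_one_eq_sum_dissipator {Q : Matrix (n × m) (n × m) ℂ}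
    (hQ : Q.IsHermitian) (s : m → ℝ) (A : Matrix n n ℂ) :
    tensorLindblad Q (unitaryDiag 1 s) A =
      ∑ k, ∑ l, (s l : ℂ) • dissipator (sndBlock Q k l) (sndBlock Q k l) A := by
  simp only [tensorLindblad_unitaryDiag_one, dissipator_eq, conjTranspose_sndBlock hQ,
    Ring.lie_def, Matrix.mul_sub, Matrix.sub_mul, Matrix.mul_smul, Matrix.smul_mul, smul_sub,
    Finset.sum_sub_distrib, Matrix.mul_assoc, two_smul, smul_add, Finset.sum_add_distrib,
    Complex.coe_smul]
  rw [Finset.sum_comm (f := fun k l => s k • (sndBlock Q k l * (sndBlock Q l k * A))),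
    Finset.sum_comm (f := fun k l => s k • (sndBlock Q l k * (A * sndBlock Q k l)))]
  abel

/-- The symmetric weight `c k l = (σ k * σ l)^(-1/4)` for the eigenvalues `σ` of the equilibrium
state of a Hamiltonian with eigenvalues `h`. -/
def tensorWeight (β : ℝ) (h : n → ℝ) (k l : n) : ℝ :=
  √(∑ j, Real.exp (-(β * h j))) * Real.exp (β * (h k + h l) / 4)

omit [DecidableEq n] in
theorem gibbsWeight_mul_tensorWeight_sq (β : ℝ) (h : n → ℝ) (k l : n) :
    gibbsWeight β h l * tensorWeight β h k l ^ 2 = Real.exp (β * (h k - h l) / 2) := by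
  have : Nonempty n := ⟨k⟩
  have hZ := partition_pos β h
  rw [gibbsWeight, tensorWeight, mul_pow, Real.sq_sqrt hZ.le, ← Real.exp_nat_mul,
    mul_mul_mul_comm, inv_mul_cancel₀ hZ.ne', one_mul, ← Real.exp_add]
  congr 1
  push_cast
  ring

/-- The operator on `𝔥 ⊗ 𝔥` with blocks `c k l • B |l⟩⟨k|` for the weight `c = tensorWeight β h`,
where `B` is an operator on `L(𝔥)`, as a matrix in the basis of matrix units. -/
def gibbsTensor (β : ℝ) (h : n → ℝ) (B : Matrix (n × n) (n × n) ℂ) :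
    Matrix (n × n) (n × n) ℂ :=
  Matrix.of fun x y => (tensorWeight β h x.2 y.2 : ℂ) * B (x.1, y.1) (y.2, x.2)

variable {h : n → ℝ} {B : Matrix (n × n) (n × n) ℂ}

omit [DecidableEq n] in
theorem isHermitian_gibbsTensor (β : ℝ) (h : n → ℝ) (hB : B.IsHermitian)
    (hswap : ∀ x y : n × n, B y.swap x.swap = B x y) : (gibbsTensor β h B).IsHermitian := by
  ext x y
  rw [Matrix.conjTranspose_apply, gibbsTensor, Matrix.of_apply, Matrix.of_apply, star_mul',
    Complex.star_def, Complex.conj_ofReal, tensorWeight, add_comm (h y.2), ← tensorWeight,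
    ← Complex.star_def, hB.apply]
  exact congrArg _ (hswap (x.1, y.1) (y.2, x.2))

theorem lie_unitaryConj_gibbsTensor (U : Matrix.unitaryGroup n ℂ) (β : ℝ)
    (hfreq : ∀ x y : n × n, B x y ≠ 0 → h x.2 - h x.1 = h y.2 - h y.1) :
    ⁅unitaryConj (kroneckerUnitary U U) (gibbsTensor β h B),
      gibbs β (unitaryDiag U h) ⊗ₖ gibbs β (unitaryDiag U h)⁆ = 0 := by
  rw [gibbs_unitaryDiag, unitaryDiag_kronecker, Ring.lie_def, sub_eq_zero,
    ← one_smul ℂ (unitaryDiag _ _ * _), ← Complex.ofReal_one,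
    unitaryConj_mul_unitaryDiag_eq_smul_iff]
  intro x y hxy
  have hsum := hfreq _ _ (right_ne_zero_of_mul hxy)
  rw [one_mul, gibbsWeight, gibbsWeight, gibbsWeight, gibbsWeight, mul_mul_mul_comm,
    mul_mul_mul_comm _ (Real.exp (-(β * h x.1))), ← Real.exp_add, ← Real.exp_add]
  congr 2
  linear_combination (-β) * hsum

theorem sum_ketBra_sndBlock_gibbsTensor (β : ℝ) (hB : B.IsHermitian)
    (hfreq : ∀ x y : n × n, B x y ≠ 0 → h x.2 - h x.1 = h y.2 - h y.1) :
    ∑ k, ∑ l, (gibbsWeight β h l : ℂ) • ketBra (sndBlock (gibbsTensor β h B) k l)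
      (sndBlock (gibbsTensor β h B) k l) = modularSqrt β h * (B * B) := by
  ext x y
  have hterm (k l : n) : ((gibbsWeight β h l : ℂ) • ketBra (sndBlock (gibbsTensor β h B) k l)
      (sndBlock (gibbsTensor β h B) k l)) x y =
      (Real.exp (β * (h x.2 - h x.1) / 2) : ℂ) * (B x (l, k) * B (l, k) y) := by
    simp only [Matrix.smul_apply, smul_eq_mul, ketBra, sndBlock, gibbsTensor, Matrix.of_apply,
      Prod.mk.eta, star_mul', Complex.star_def, Complex.conj_ofReal]
    rw [← Complex.star_def, hB.apply]
    by_cases hx : B x (l, k) = 0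
    · rw [hx, zero_mul, mul_zero, mul_zero, zero_mul, mul_zero]
    · rw [hfreq _ _ hx, ← gibbsWeight_mul_tensorWeight_sq]
      push_cast
      ring
  simp only [Matrix.sum_apply, hterm, ← Finset.mul_sum]
  rw [modularSqrt, Matrix.diagonal_mul, Matrix.mul_apply, Fintype.sum_prod_type, Finset.sum_comm]

theorem blockLindblad_unitaryConj (U : Matrix.unitaryGroup n ℂ) (β ω : ℝ) (Q A : Matrix n n ℂ) :
    blockLindblad β ω (unitaryConj U Q) (unitaryConj U A) =
      unitaryConj U (blockLindblad β ω Q A) := by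
  simp only [blockLindblad_eq, dissipator_eq, ← Matrix.star_eq_conjTranspose, ← map_star,
    ← map_mul, ← map_smul, ← map_sub, ← map_add]

open scoped MatrixOrder in
theorem exists_tensorLindblad_eq_sum_blockLindblad {ι : Type*} [Fintype ι] {H : Matrix n n ℂ}
    (hH : H.IsHermitian) (β : ℝ) {ω : ι → ℝ} {Q : ι → Matrix n n ℂ}
    (hQ : ∀ m, IsEigenpair H (ω m) (Q m)) :
    ∃ R : Matrix (n × n) (n × n) ℂ, R.IsHermitian ∧ ⁅R, gibbs β H ⊗ₖ gibbs β H⁆ = 0 ∧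
      ∀ A, tensorLindblad R (gibbs β H) A = ∑ m, blockLindblad β (ω m) (Q m) A := by
  obtain ⟨U, h, rfl⟩ := exists_eq_unitaryDiag hH
  choose q hq using fun m => unitaryConj_surjective U (Q m)
  obtain rfl : (fun m => unitaryConj U (q m)) = Q := funext hq
  replace hQ := fun m => isEigenpair_unitaryDiag_iff.1 (hQ m)
  set B := CFC.sqrt (blockGram q)
  have hB : B.IsHermitian := (Matrix.nonneg_iff_posSemidef.1 (CFC.sqrt_nonneg _)).isHermitian
  have hBB : B * B = blockGram q := CFC.sqrt_mul_sqrt_self _ (posSemidef_blockGram q).nonneg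
  have hswap (x y : n × n) : B y.swap x.swap = B x y := by
    have hgram : (blockGram q)ᵀ.submatrix (Equiv.prodComm n n) (Equiv.prodComm n n) =
        blockGram q := Matrix.ext (blockGram_swap q)
    have hsqrt := sqrt_transpose_submatrix (posSemidef_blockGram q) (Equiv.prodComm n n)
    rw [hgram] at hsqrt
    exact (congrFun (congrFun hsqrt x) y).symm
  have hfreq (x y : n × n) : B x y ≠ 0 → h x.2 - h x.1 = h y.2 - h y.1 :=
    eq_of_sqrt_apply_ne_zero (g := fun x : n × n => h x.2 - h x.1) fun _ _ => blockGram_frequency hQ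
  have hR := isHermitian_gibbsTensor β h hB hswap
  refine ⟨unitaryConj (kroneckerUnitary U U) (gibbsTensor β h B), ?_,
    lie_unitaryConj_gibbsTensor U β hfreq, fun A => ?_⟩
  · rw [Matrix.IsHermitian, ← Matrix.star_eq_conjTranspose, ← map_star,
      Matrix.star_eq_conjTranspose, hR.eq]
  · obtain ⟨A, rfl⟩ := unitaryConj_surjective U A
    rw [gibbs_unitaryDiag, ← mul_one U, ← unitaryConj_unitaryDiag, mul_one,
      tensorLindblad_unitaryConj, tensorLindblad_unitaryDiag_one_eq_sum_dissipator hR]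
    simp only [blockLindblad_unitaryConj, ← map_sum, ← kossakowski_ketBra, ← map_smul]
    rw [sum_ketBra_sndBlock_gibbsTensor β hB hfreq, hBB, kossakowski_modularSqrt_mul_blockGram hQ]

end TensorExistence

end

end LindbladGradient

theorem mainTheorem1 {n : Type*} [Fintype n] [DecidableEq n]
    (H : Matrix n n ℂ) (hH : H.IsHermitian) (β : ℝ) (hβ : 0 < β)
    (L : Matrix n n ℂ →ₗ[ℂ] Matrix n n ℂ)
    (hL : IsLindblad L)
    (hDBC : DetailedBalance L (gibbs β H)) :
    -- existence of an Onsager operator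
    (∃ K : Matrix n n ℂ → Matrix n n ℂ → Matrix n n ℂ,
      IsOnsager K ∧ IsEntropicGradient β H L K) ∧
    -- existence of a tensor representation of `L`
    (∃ Q : Matrix (n × n) (n × n) ℂ, Q.IsHermitian ∧
      ⁅Q, gibbs β H ⊗ₖ gibbs β H⁆ = 0 ∧
      ∀ A, L A = tensorLindblad Q (gibbs β H) A) ∧
    -- the Onsager operator in tensor form, for every tensor representation of `L`
    (∀ Q : Matrix (n × n) (n × n) ℂ, Q.IsHermitian →
      ⁅Q, gibbs β H ⊗ₖ gibbs β H⁆ = 0 →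
      (∀ A, L A = tensorLindblad Q (gibbs β H) A) →
      IsOnsager
        (tensorOnsager Q (gibbs β H)) ∧
      IsEntropicGradient β H L
        (tensorOnsager Q (gibbs β H)) ∧
      -- the dual tensor form, for every orthonormal eigenbasis of the equilibrium state
      ∀ U ∈ Matrix.unitaryGroup n ℂ, ∀ s : n → ℝ,
        gibbs β H =
          U * Matrix.diagonal (fun j => (s j : ℂ)) * Uᴴ →
        (∀ A, L A = tensorLindblad
          (dualQ (gibbs β H) U Q)
          (gibbs β H)⁻¹ A) ∧
        ∀ ρ, IsDensity ρ → ∀ ξ,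
          tensorOnsager Q (gibbs β H) ρ ξ =
            tensorOnsager
              (dualQ (gibbs β H) U Q)
              (gibbs β H)⁻¹ ρ ξ) ∧
    -- existence of a representation of `L` by building blocks
    (∃ (M : ℕ) (ω : Fin M → ℝ) (Q : Fin M → Matrix n n ℂ),
      (∀ m, IsEigenpair H (ω m) (Q m)) ∧
      ∀ A, L A = ∑ m, blockLindblad β (ω m) (Q m) A) ∧
    -- the additive Onsager operator, for every representation of `L` by building blocks
    (∀ (M : ℕ) (ω : Fin M → ℝ) (Q : Fin M → Matrix n n ℂ),
      (∀ m, IsEigenpair H (ω m) (Q m)) →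
      (∀ A, L A = ∑ m, blockLindblad β (ω m) (Q m) A) →
      IsOnsager
        (fun ρ ξ => ∑ m, blockOnsager β (ω m) (Q m) ρ ξ) ∧
      IsEntropicGradient β H L
        (fun ρ ξ => ∑ m, blockOnsager β (ω m) (Q m) ρ ξ)) := by
  obtain ⟨M, ω, V, hV, hLV⟩ := hDBC.exists_sum_blockLindblad hL hH hβ.ne'
  obtain ⟨Q, hQ, hQσ, hQV⟩ := exists_tensorLindblad_eq_sum_blockLindblad hH β hV
  have hLQ (A : Matrix n n ℂ) : L A = tensorLindblad Q (gibbs β H) A := (hLV A).trans (hQV A).symm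
  have hσ : (gibbs β H).PosDef := posDef_gibbs hH β
  refine ⟨⟨tensorOnsager Q (gibbs β H), isOnsager_tensorOnsager hQ hσ.posSemidef,
      isEntropicGradient_tensorOnsager hH β hQ hσ hQσ hLQ⟩, ⟨Q, hQ, hQσ, hLQ⟩,
    fun Q hQ hQσ hLQ => ⟨isOnsager_tensorOnsager hQ hσ.posSemidef,
      isEntropicGradient_tensorOnsager hH β hQ hσ hQσ hLQ, fun U hU s hs => ?_⟩,
    ⟨M, ω, V, hV, hLV⟩,
    fun M ω Q hQ hLQ => ⟨isOnsager_sum fun m => isOnsager_blockOnsager β (ω m) (Q m),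
      isEntropicGradient_sum_blockOnsager hH β hQ hLQ⟩⟩
  replace hs : gibbs β H = unitaryDiag ⟨U, hU⟩ s := hs
  rw [hs, posDef_unitaryDiag_iff] at hσ
  simp only [hs] at hLQ ⊢
  exact ⟨fun A => (hLQ A).trans (tensorLindblad_dualQ ⟨U, hU⟩ hσ Q A).symm,
    fun ρ hρ ξ => (tensorOnsager_dualQ ⟨U, hU⟩ hσ Q hρ.1 ξ).symm⟩
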